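/- Let $n\ge 1$ and $c>0$. Let $a\in C^2([0,\infty))$ be positive with $a(0)=1$, and let $v_0\in C^2(\mathbb R^n;\mathbb R^n)$ have bounded $C^2$ norm. For $\varepsilon\ge 0$ consider the Cauchy problem for the relativistic Burgers equation $$\partial_t v^i+\sum_{j=1}^n\frac{v^j}{a(t)}\,\partial_{x^j}v^i+\frac{\dot a(t)}{a(t)}v^i-\frac{\dot a(t)}{a(t)}\frac{|v|^2}{c^2}v^i=0\quad(1\le i\le n),\qquad v(0,x)=\varepsilon v_0(x).$$ A classical solution on $[0,T)\times\mathbb R^n$ is a $C^1$ solution; it is global if $T=\infty$. The life span $T(\varepsilon)\in[0,\infty]$ is the supremum of all $T$ for which there is a classical solution on $[0,T)\times\mathbb R^n$. Consider the following assumptions, for all $t\ge 0$. - $H_1$: $\dot a>0$ and $\ddot a\ge 0$. - $H_2$: $\dot a>0$, $\ddot a<0$, and $a(t)\ge(1+t)^{(1+\delta_0)/2}$ for some $0<\delta_0<1$. - $H_3$ with exponent $l\in(0,\tfrac12]$: $\dot a>0$, $\ddot a<0$, and $k(1+t)^l\le a(t)\le K(1+t)^l$ for some constants $k,K>0$. -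 $H_4$: $a\equiv 1$ (in this case put $l=0$). Let $\frac{\partial v_0}{\partial\alpha}=\big(\frac{\partial v_0^i}{\partial\alpha^j}\big)_{ij}$ and $f_0(\alpha)=\varepsilon|v_0(\alpha)|/\sqrt{c^2-\varepsilon^2|v_0(\alpha)|^2}$, and, with $v_0=v_0(\alpha)$ regarded as a row vector in $v_0^Tv_0$, let $$V(t,\alpha)=I+\frac{c^3\varepsilon}{[c^2-\varepsilon^2|v_0|^2]^{3/2}}\int_0^t\frac{a^{-2}(s)\,ds}{[1+f_0^2(\alpha)a^{-2}(s)]^{3/2}}\;\frac{\partial v_0}{\partial\alpha}-\frac{c\,\varepsilon^3}{[c^2-\varepsilon^2|v_0|^2]^{3/2}}\int_0^t\frac{a^{-2}(s)-a^{-4}(s)}{[1+f_0^2(\alpha)a^{-2}(s)]^{3/2}}\,ds\;\big(|v_0|^2I-v_0^Tv_0\big)\frac{\partial v_0}{\partial\alpha}.$$ Then there is $\varepsilon_0>0$ with $\varepsilon_0|v_0(\alpha)|<c$ for all $\alpha$ such that for every $\varepsilon\in[0,\varepsilon_0]$ there is a classical solution on $[0,T(\varepsilon))\times\mathbb R^n$,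 $T(0)=\infty$, and the following hold. **Life span.** - Under $H_1$ or $H_2$, $T(\varepsilon)=\infty$ for all $\varepsilon\in[0,\varepsilon_0]$. - Under $H_3$ with $l\ne\frac12$, or under $H_4$, there are constants $P,P',Q,Q'>0$ independent of $\varepsilon$ such that for all $\varepsilon\in(0,\varepsilon_0]$ $$T(\varepsilon)\ge\varepsilon^{\frac{P}{2l-1}}-1,\qquad T(\varepsilon)\ge\Big(\frac Q\varepsilon+1\Big)^{\frac1{1-2l}}-1,$$ and, if $\det\frac{\partial v_0}{\partial\alpha}(\alpha)<0$ for some $\alpha$ (for $n=1$ this says $v_0'(\alpha)<0$), or if $H_4$ holds and $T(\varepsilon)<\infty$, also $$T(\varepsilon)\le\varepsilon^{\frac{P'}{2l-1}}-1,\qquad T(\varepsilon)\le\Big(\frac{Q'}\varepsilon+1\Big)^{\frac1{1-2l}}-1.$$ - Under $H_3$ with $l=\frac12$ (in particular for $a(t)=(1+t)^{1/2}$) there are constants $P,P'>0$ independent of $\varepsilon$ such that for all $\varepsilon\in(0,\varepsilon_0]$ we have $T(\varepsilon)\ge e^{P/\varepsilon}-1$, and, if $\det\frac{\partial v_0}{\partial\alpha}(\alpha)<0$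 for some $\alpha$, also $T(\varepsilon)\le e^{P'/\varepsilon}-1$. **Criteria under $H_3$.** 1. Let $n=1$. If $\inf_\alpha v_0'(\alpha)\ge 0$, there is a global classical solution for every $\varepsilon\in[0,\varepsilon_0]$. If $\inf_\alpha v_0'(\alpha)<0$, then for every $\varepsilon\in(0,\varepsilon_0]$ we have $0<T(\varepsilon)<\infty$, and every classical solution on $[0,T(\varepsilon))\times\mathbb R$ satisfies $\sup_x|v_x(t,x)|\to\infty$ as $t\uparrow T(\varepsilon)$. 2. Let $n>1$. For every $\varepsilon\in[0,\varepsilon_0]$ there is a global classical solution if and only if $\det V(t,\alpha)>0$ for all $t>0$ and $\alpha\in\mathbb R^n$. -/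

import Mathlib

open Set Filter Topology

noncomputable section

namespace RelBurgers

/-! ### The scale factor -/

/-- First time derivative on `[0, ∞)` (one-sided at `t = 0`). -/
def dot (a : ℝ → ℝ) (t : ℝ) : ℝ := derivWithin a (Ici 0) t

/-- Second time derivative on `[0, ∞)` (one-sided at `t = 0`). -/
def ddot (a : ℝ → ℝ) (t : ℝ) : ℝ := derivWithin (dot a) (Ici 0) t

/-- A positive `C²` scale factor on `[0, ∞)`, normalized by `a(0) = 1`. -/
structure IsScaleFactor (a : ℝ → ℝ) : Prop where
  contDiffOn : ContDiffOn ℝ 2 a (Ici 0)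
  pos : ∀ t, 0 ≤ t → 0 < a t
  init : a 0 = 1

/-- Assumption `H₁`. -/
def H1 (a : ℝ → ℝ) : Prop :=
  ∀ t, 0 ≤ t → 0 < dot a t ∧ 0 ≤ ddot a t

/-- Assumption `H₂`. -/
def H2 (a : ℝ → ℝ) : Prop :=
  (∀ t, 0 ≤ t → 0 < dot a t ∧ ddot a t < 0) ∧
    ∃ δ₀ : ℝ, 0 < δ₀ ∧ δ₀ < 1 ∧ ∀ t, 0 ≤ t → (1 + t) ^ ((1 + δ₀) / 2) ≤ a t

/-- Assumption `H₃` with exponent `l`: here `a(t) ∼ (1 + t)^l` means that `a(t)` lies between two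
positive constant multiples of `(1 + t)^l`. -/
def H3 (a : ℝ → ℝ) (l : ℝ) : Prop :=
  (∀ t, 0 ≤ t → 0 < dot a t ∧ ddot a t < 0) ∧ 0 < l ∧ l ≤ 1 / 2 ∧
    ∃ k K : ℝ, 0 < k ∧ 0 < K ∧ ∀ t, 0 ≤ t → k * (1 + t) ^ l ≤ a t ∧ a t ≤ K * (1 + t) ^ l

/-- Assumption `H₄`. -/
def H4 (a : ℝ → ℝ) : Prop := ∀ t, 0 ≤ t → a t = 1

/-! ### The Cauchy problem -/

variable {n : ℕ}

/-- The Jacobian matrix `(∂wⁱ/∂xʲ)` of `w : ℝⁿ → ℝⁿ` at `x` (row `i`, column `j`). -/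
def jac (w : EuclideanSpace ℝ (Fin n) → EuclideanSpace ℝ (Fin n))
    (x : EuclideanSpace ℝ (Fin n)) : Matrix (Fin n) (Fin n) ℝ :=
  Matrix.of fun i j => fderiv ℝ w x (EuclideanSpace.single j 1) i

/-- `w` is of class `C²` with bounded `C²` norm. -/
def BoundedC2 (w : EuclideanSpace ℝ (Fin n) → EuclideanSpace ℝ (Fin n)) : Prop :=
  ContDiff ℝ 2 w ∧
    ∃ N : ℝ, ∀ x, ‖w x‖ ≤ N ∧ ‖fderiv ℝ w x‖ ≤ N ∧ ‖iteratedFDeriv ℝ 2 w x‖ ≤ N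

/-- `v` is a classical (that is, `C¹`) solution on `[0, T) × ℝⁿ` of the relativistic Burgers
equation
`∂ₜvⁱ + ∑ⱼ (vʲ / a) ∂ⱼvⁱ + (ȧ / a) vⁱ - (ȧ / a) (|v|² / c²) vⁱ = 0`, with `v(0, ·) = w`. -/
structure IsClassicalSolution (a : ℝ → ℝ) (c : ℝ)
    (w : EuclideanSpace ℝ (Fin n) → EuclideanSpace ℝ (Fin n)) (T : EReal)
    (v : ℝ → EuclideanSpace ℝ (Fin n) → EuclideanSpace ℝ (Fin n)) : Prop where
  contDiffOn : ContDiffOn ℝ 1 (Function.uncurry v) ({t : ℝ | 0 ≤ t ∧ (t : EReal) < T} ×ˢ univ)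
  equation : ∀ t : ℝ, 0 ≤ t → (t : EReal) < T → ∀ x, ∀ i,
    derivWithin (fun s => v s x i) (Ici 0) t
      + ∑ j, v t x j / a t * jac (v t) x i j
      + dot a t / a t * v t x i
      - dot a t / a t * (‖v t x‖ ^ 2 / c ^ 2) * v t x i = 0
  init : 0 < T → ∀ x, v 0 x = w x

/-- The life span: the supremum of all `T` such that the Cauchy problem with data `w` has a
classical solution on `[0, T) × ℝⁿ`. -/
def lifespan (a : ℝ → ℝ) (c : ℝ)
    (w : EuclideanSpace ℝ (Fin n) → EuclideanSpace ℝ (Fin n)) : EReal :=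
  sSup {T : EReal | ∃ v, IsClassicalSolution a c w T v}

/-! ### The characteristic Jacobian matrix -/

/-- `f₀(α) = ε |v₀(α)| / √(c² - ε² |v₀(α)|²)`. -/
def f₀ (c ε : ℝ) (v₀ : EuclideanSpace ℝ (Fin n) → EuclideanSpace ℝ (Fin n))
    (α : EuclideanSpace ℝ (Fin n)) : ℝ :=
  ε * ‖v₀ α‖ / Real.sqrt (c ^ 2 - ε ^ 2 * ‖v₀ α‖ ^ 2)

/-- The matrix `V(t, α)`; the outer product has entries `v₀ⁱ v₀ʲ`. -/
def V (a : ℝ → ℝ) (c ε : ℝ) (v₀ : EuclideanSpace ℝ (Fin n) → EuclideanSpace ℝ (Fin n))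
    (t : ℝ) (α : EuclideanSpace ℝ (Fin n)) : Matrix (Fin n) (Fin n) ℝ :=
  1 + (c ^ 3 * ε / (c ^ 2 - ε ^ 2 * ‖v₀ α‖ ^ 2) ^ (3 / 2 : ℝ) *
        ∫ s in (0 : ℝ)..t, a s ^ (-2 : ℤ) /
          (1 + f₀ c ε v₀ α ^ 2 * a s ^ (-2 : ℤ)) ^ (3 / 2 : ℝ)) • jac v₀ α
    - (c * ε ^ 3 / (c ^ 2 - ε ^ 2 * ‖v₀ α‖ ^ 2) ^ (3 / 2 : ℝ) *
        ∫ s in (0 : ℝ)..t, (a s ^ (-2 : ℤ) - a s ^ (-4 : ℤ)) /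
          (1 + f₀ c ε v₀ α ^ 2 * a s ^ (-2 : ℤ)) ^ (3 / 2 : ℝ)) •
      ((‖v₀ α‖ ^ 2 • (1 : Matrix (Fin n) (Fin n) ℝ)
        - Matrix.of fun i j => v₀ α i * v₀ α j) * jac v₀ α)

end RelBurgers

end

/-! The characteristics are explicit. Along dx/dt = v/a the equation becomes W' = -(ȧ/a)(1 -
|W|²/c²)W, solved with W(0) = u by c u / √(a²(c² - |u|²) + |u|²) (`velocity`). Time enters only
through a, so the position X(t,α) is a plain integral (`flow`), and ∂X/∂α is the matrix V
(`V_mulVec`).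

Everything rests on one criterion, `exists_solution_iff`: a C¹ solution on [0,T) exists iff det V >
0 there. Given a solution, a Grönwall estimate yields v(t,X) = W (`IsClassicalSolution.apply_flow`).
Differentiating in α, Dv ∘ DX = B ∘ Dw with w = εv₀ and B injective. If DX k = 0 then Dw k = 0; but
DX = I + A ∘ Dw, so k = 0. Conversely, where V is invertible, X(t,·) is a local diffeomorphism at
bounded distance from the identity, hence a global one (`exists_inverse_flow`), and W composed with
its inverse solves the problem. As V = I at t = 0, "nonzero up to time t" gives "positive at time
t".

The life span is then governed by I(t) = ∫₀ᵗ a⁻². For a ≥ 1 and ε|v₀| ≤ c/2 the coefficient of Dv₀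
is comparable to εI and the second term is subordinate. So det V > 0 while 3εN·I < 1
(`det_V_pos_of_small`), and where det Dv₀ < 0, det V < 0 once εI exceeds a constant
(`exists_det_V_neg`). It remains to know I: bounded under H₁ or H₂, of order (1+t)^(1-2l) - 1 for l
< 1/2, and of order log(1+t) for l = 1/2. If a ≡ 1, V depends on t and ε only through εt.

In dimension one the second term of V vanishes, and v_x · det V stays away from 0 along suitable
characteristics on which det V is O(T - t); this forces the gradient blow-up. -/

namespace RelBurgers

/-! ### Integrals depending on a parameter and on their endpoint. -/

section ParametricPrimitive

variable {E F : Type*} [NormedAddCommGroup E] [NormedSpace ℝ E] [FiniteDimensional ℝ E]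
  [NormedAddCommGroup F] [NormedSpace ℝ F]

theorem hasFDerivAt_intervalIntegral_param {f : ℝ → E → F} {f' : ℝ → E → E →L[ℝ] F}
    (hf : Continuous (Function.uncurry f)) (hf' : Continuous (Function.uncurry f'))
    (hd : ∀ s x, HasFDerivAt (f s) (f' s x) x) (t : ℝ) (x : E) :
    HasFDerivAt (fun y => ∫ s in (0 : ℝ)..t, f s y) (∫ s in (0 : ℝ)..t, f' s x) x := by
  obtain ⟨M, hM⟩ := ((isCompact_uIcc (a := (0 : ℝ)) (b := t)).prod
    (ProperSpace.isCompact_closedBall x 1)).exists_bound_of_continuousOn hf'.continuousOn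
  have c1 : ∀ y, Continuous fun s => f s y := fun y => hf.comp (by fun_prop : Continuous fun s => (s, y))
  have c2 : ∀ y, Continuous fun s => f' s y := fun y =>
    hf'.comp (by fun_prop : Continuous fun s => (s, y))
  refine intervalIntegral.hasFDerivAt_integral_of_dominated_of_fderiv_le
    (F := fun y s => f s y) (F' := fun y s => f' s y) (bound := fun _ => M)
    (Metric.closedBall_mem_nhds x one_pos)
    (Eventually.of_forall fun y => (c1 y).aestronglyMeasurable)
    ((c1 x).intervalIntegrable _ _) (c2 x).aestronglyMeasurable
    (Eventually.of_forall fun s hs y hy => hM (s, y) ⟨uIoc_subset_uIcc hs, hy⟩)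
    intervalIntegrable_const (Eventually.of_forall fun s _ y _ => hd s y)

/-- Both partial derivatives, the integrand at the endpoint and the integral of f', are jointly
continuous. -/
theorem contDiff_intervalIntegral_param [CompleteSpace F] {f : ℝ → E → F} {f' : ℝ → E → E →L[ℝ] F}
    (hf : Continuous (Function.uncurry f)) (hf' : Continuous (Function.uncurry f'))
    (hd : ∀ s x, HasFDerivAt (f s) (f' s x) x) :
    ContDiff ℝ 1 (fun p : ℝ × E => ∫ s in (0 : ℝ)..p.1, f s p.2) := by
  rw [contDiff_one_iff_hasFDerivAt]
  have c2 : Continuous fun p : ℝ × E => ∫ s in (0 : ℝ)..p.1, f' s p.2 :=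
    intervalIntegral.continuous_parametric_intervalIntegral_of_continuous
      (f := fun (p : ℝ × E) s => f' s p.2) (hf'.comp (by fun_prop :
        Continuous fun q : (ℝ × E) × ℝ => (q.2, q.1.2))) continuous_fst
  have c1 : Continuous fun p : ℝ × E => ContinuousLinearMap.toSpanSingleton ℝ (f p.1 p.2) :=
    (ContinuousLinearMap.toSpanSingletonCLE (𝕜 := ℝ) (E := F)).continuous.comp hf
  refine ⟨fun p => (ContinuousLinearMap.toSpanSingleton ℝ (f p.1 p.2)).coprod
    (∫ s in (0 : ℝ)..p.1, f' s p.2), ?_, fun p => ?_⟩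
  · refine ((c1.clm_comp (continuous_const (y := ContinuousLinearMap.fst ℝ ℝ E))).add
      (c2.clm_comp (continuous_const (y := ContinuousLinearMap.snd ℝ ℝ E)))).congr fun p => ?_
    ext <;> simp
  · have := hasStrictFDerivAt_uncurry_coprod (𝕜 := ℝ) (u := p)
      (f := fun t x => ∫ s in (0 : ℝ)..t, f s x)
      (f₁ := fun t x => ContinuousLinearMap.toSpanSingleton ℝ (f t x))
      (f₂ := fun t x => ∫ s in (0 : ℝ)..t, f' s x)
      (Eventually.of_forall fun v => by
        have cv : Continuous fun s => f s v.2 :=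
          hf.comp (by fun_prop : Continuous fun s => (s, v.2))
        exact (intervalIntegral.integral_hasDerivAt_right (cv.intervalIntegrable _ _)
          (cv.stronglyMeasurableAtFilter _ _) cv.continuousAt).hasFDerivAt)
      (Eventually.of_forall fun v => hasFDerivAt_intervalIntegral_param hf hf' hd v.1 v.2)
      c1.continuousAt c2.continuousAt
    exact this.hasFDerivAt

end ParametricPrimitive

/-! ### Global inversion of a flow at bounded distance from the identity. -/

section GlobalInverse

variable {E : Type*} [NormedAddCommGroup E] [NormedSpace ℝ E] [FiniteDimensional ℝ E]

/-- The time slab `[0, T)`. -/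
abbrev slab (T : EReal) : Set ℝ := {t : ℝ | 0 ≤ t ∧ (t : EReal) < T}

/-- Including time in the map makes its local inverse C¹ in time and space together. The derivative
is block triangular, so in finite dimension an injective spatial block makes it invertible. -/
theorem exists_equiv_hasStrictFDerivAt_graph {X : ℝ × E → E} (hX : ContDiff ℝ 1 X) {t : ℝ} {α : E}
    (hinj : ∀ k, fderiv ℝ (fun β => X (t, β)) α k = 0 → k = 0) :
    ∃ L : (ℝ × E) ≃L[ℝ] (ℝ × E),
      HasStrictFDerivAt (fun p : ℝ × E => (p.1, X p)) (L : (ℝ × E) →L[ℝ] (ℝ × E)) (t, α) := by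
  have hs := hX.contDiffAt.hasStrictFDerivAt (x := (t, α)) one_ne_zero
  set D := fderiv ℝ X (t, α)
  have hD : ∀ k, fderiv ℝ (fun β => X (t, β)) α k = D (0, k) := fun k => by
    have h2 : HasFDerivAt (fun β => X (t, β)) (D.comp (ContinuousLinearMap.inr ℝ ℝ E)) α :=
      hs.hasFDerivAt.comp α (hasFDerivAt_prodMk_right t α)
    rw [h2.fderiv]; simp
  let M : (ℝ × E) →L[ℝ] (ℝ × E) := (ContinuousLinearMap.fst ℝ ℝ E).prod D
  have hM : Function.Injective M := by
    rw [injective_iff_map_eq_zero]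
    rintro ⟨h, k⟩ hk
    have h0 : h = 0 := congrArg Prod.fst hk
    subst h0
    have : k = 0 := hinj k (by rw [hD]; exact congrArg Prod.snd hk)
    simp [this]
  let L : (ℝ × E) ≃L[ℝ] (ℝ × E) :=
    (LinearEquiv.ofInjectiveEndo M.toLinearMap hM).toContinuousLinearEquiv
  refine ⟨L, ?_⟩
  have : (L : (ℝ × E) →L[ℝ] (ℝ × E)) = M := by ext x <;> rfl
  rw [this]
  exact hasStrictFDerivAt_fst.prodMk hs

variable {X : ℝ × E → E}

/-- The range is open by the inverse function theorem, and closed because preimages of a convergent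
sequence stay bounded and so subconverge. -/
theorem surjective_of_bounded_displacement (hX : ContDiff ℝ 1 X) {t : ℝ}
    (hinj : ∀ α k, fderiv ℝ (fun β => X (t, β)) α k = 0 → k = 0)
    {C : ℝ} (hC : ∀ α, ‖X (t, α) - α‖ ≤ C) : Function.Surjective fun α => X (t, α) := by
  have hcont : Continuous fun α => X (t, α) := hX.continuous.comp (by fun_prop)
  have hopen : IsOpen (range fun α => X (t, α)) := by
    rw [isOpen_iff_mem_nhds]
    rintro _ ⟨α, rfl⟩
    obtain ⟨L, hL⟩ := exists_equiv_hasStrictFDerivAt_graph hX (hinj α)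
    have hm := hL.map_nhds_eq_of_equiv
    have : range (fun p : ℝ × E => (p.1, X p)) ∈ 𝓝 (t, X (t, α)) := by
      rw [← hm]; exact range_mem_map
    have h2 : Tendsto (fun y : E => (t, y)) (𝓝 (X (t, α))) (𝓝 (t, X (t, α))) :=
      (by fun_prop : Continuous fun y : E => (t, y)).tendsto _
    filter_upwards [h2 this] with y hy
    obtain ⟨⟨t', β⟩, hβ⟩ := hy
    simp only [Prod.mk.injEq] at hβ
    obtain ⟨rfl, rfl⟩ := hβ
    exact ⟨β, rfl⟩
  have hclosed : IsClosed (range fun α => X (t, α)) := by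
    rw [← isSeqClosed_iff_isClosed]
    intro y y₀ hy hlim
    choose α hα using hy
    have hb : ∃ R, ∀ k, ‖α k‖ ≤ R := by
      obtain ⟨R, hR⟩ := (Metric.isBounded_range_of_tendsto y hlim).exists_norm_le
      refine ⟨R + C, fun k => ?_⟩
      have h1 := hC (α k)
      have h2 := hR (y k) (mem_range_self k)
      have h3 : α k = y k - (X (t, α k) - α k) := by rw [← hα k]; simp
      rw [h3]
      exact (norm_sub_le _ _).trans (add_le_add h2 h1)
    obtain ⟨R, hR⟩ := hb
    obtain ⟨α₀, -, φ, hφ, hlimφ⟩ := (ProperSpace.isCompact_closedBall (0 : E) R).tendsto_subseq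
      (x := α) (fun k => by simpa using hR k)
    refine ⟨α₀, tendsto_nhds_unique ((hcont.tendsto α₀).comp hlimφ) ?_⟩
    have := hlim.comp hφ.tendsto_atTop
    refine this.congr fun k => ?_
    simp [← hα]
  have := IsClopen.eq_univ ⟨hclosed, hopen⟩ (range_nonempty _)
  exact range_eq_univ.mp this

/-- Continuation in time for a fixed target y: having only one preimage of y is an open and closed
condition on t, and it holds at t = 0. -/
theorem injective_of_bounded_displacement (hX : ContDiff ℝ 1 X) {t₁ : ℝ} (h₁ : 0 ≤ t₁)
    (h0 : ∀ α, X (0, α) = α)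
    (hinj : ∀ t ∈ Icc 0 t₁, ∀ α k, fderiv ℝ (fun β => X (t, β)) α k = 0 → k = 0)
    {C : ℝ} (hC : ∀ t ∈ Icc 0 t₁, ∀ α, ‖X (t, α) - α‖ ≤ C) :
    Function.Injective fun α => X (t₁, α) := by
  suffices H : ∀ y, ∀ t ∈ Icc 0 t₁, ∀ α β, X (t, α) = y → X (t, β) = y → α = β from
    fun α β h => H _ t₁ ⟨h₁, le_rfl⟩ α β rfl h.symm
  intro y
  set P : ℝ → Prop := fun t => ∀ α β, X (t, α) = y → X (t, β) = y → α = β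
  have hpos : ∀ t₀ ∈ Icc 0 t₁, P t₀ → ∀ᶠ t in 𝓝[Icc 0 t₁] t₀, P t := by
    intro t₀ ht₀ hP
    obtain ⟨α₀, hα₀⟩ := surjective_of_bounded_displacement hX (hinj t₀ ht₀) (hC t₀ ht₀) y
    simp only at hα₀
    obtain ⟨L, hL⟩ := exists_equiv_hasStrictFDerivAt_graph hX (hinj t₀ ht₀ α₀)
    obtain ⟨U, hU, hUinj⟩ : ∃ U ∈ 𝓝 (t₀, α₀), InjOn (fun p : ℝ × E => (p.1, X p)) U :=
      ⟨_, (hL.toOpenPartialHomeomorph _).open_source.mem_nhds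
        hL.mem_toOpenPartialHomeomorph_source, (hL.toOpenPartialHomeomorph _).injOn⟩
    rw [mem_nhds_prod_iff] at hU
    obtain ⟨U₁, hU₁, U₂, hU₂, hsub⟩ := hU
    obtain ⟨O, hO2, hO, hαO⟩ := mem_nhds_iff.mp hU₂
    -- Preimages of y outside the neighbourhood O of α₀. They lie within C of y, so K is compact;
    -- its projection to time is closed and misses t₀, which keeps stray preimages away at nearby
    -- times.
    let K : Set (ℝ × E) := (Icc 0 t₁ ×ˢ Metric.closedBall y C) ∩ ({p | X p = y} ∩ {p | p.2 ∉ O})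
    have hK : IsCompact K := by
      refine (isCompact_Icc.prod (ProperSpace.isCompact_closedBall y C)).inter_right ?_
      exact (isClosed_eq hX.continuous continuous_const).inter
        (hO.isClosed_compl.preimage continuous_snd)
    have hKc : IsClosed (Prod.fst '' K) := (hK.image continuous_fst).isClosed
    have ht₀K : t₀ ∉ Prod.fst '' K := by
      rintro ⟨⟨t, α⟩, ⟨-, hα, hαO'⟩, rfl⟩
      exact hαO' (by rw [hP α α₀ hα hα₀]; exact hαO)
    filter_upwards [self_mem_nhdsWithin, mem_nhdsWithin_of_mem_nhds hU₁,
      mem_nhdsWithin_of_mem_nhds (hKc.isOpen_compl.mem_nhds ht₀K)] with t ht htU htK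
    have hin : ∀ α, X (t, α) = y → α ∈ O := by
      intro α hα
      by_contra hno
      refine htK ⟨(t, α), ⟨⟨ht, ?_⟩, hα, hno⟩, rfl⟩
      have := hC t ht α
      rw [hα] at this
      rw [Metric.mem_closedBall, dist_comm, dist_eq_norm]
      exact this
    intro α β hα hβ
    have := hUinj (hsub (mk_mem_prod htU (hO2 (hin α hα)))) (hsub (mk_mem_prod htU (hO2 (hin β hβ))))
      (by simp [hα, hβ])
    exact congrArg Prod.snd this
  have hneg : ∀ t₀ ∈ Icc 0 t₁, ¬ P t₀ → ∀ᶠ t in 𝓝[Icc 0 t₁] t₀, ¬ P t := by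
    intro t₀ ht₀ hP
    simp only [P, not_forall] at hP
    obtain ⟨α, β, hα, hβ, hne⟩ := hP
    -- A preimage persists nearby for nearby times, so two distinct preimages stay distinct.
    have key : ∀ γ, X (t₀, γ) = y → ∀ W ∈ 𝓝 γ, ∀ᶠ t in 𝓝 t₀, ∃ γ' ∈ W, X (t, γ') = y := by
      intro γ hγ W hW
      obtain ⟨L, hL⟩ := exists_equiv_hasStrictFDerivAt_graph hX (hinj t₀ ht₀ γ)
      have hm := hL.map_nhds_eq_of_equiv
      have h1 : (fun p : ℝ × E => (p.1, X p)) '' (univ ×ˢ W) ∈ 𝓝 (t₀, y) := by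
        rw [← hγ, ← hm]
        exact image_mem_map (prod_mem_nhds univ_mem hW)
      have h2 : Tendsto (fun s : ℝ => (s, y)) (𝓝 t₀) (𝓝 (t₀, y)) :=
        (by fun_prop : Continuous fun s : ℝ => (s, y)).tendsto _
      filter_upwards [h2 h1] with t ht
      obtain ⟨⟨t', γ'⟩, ⟨-, hγ'⟩, he⟩ := ht
      simp only [Prod.mk.injEq] at he
      obtain ⟨rfl, he⟩ := he
      exact ⟨γ', hγ', he⟩
    obtain ⟨A, hA, B, hB, hAB⟩ := (disjoint_nhds_nhds.mpr hne).exists_mem_filter_basis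
      (𝓝 α).basis_sets (𝓝 β).basis_sets
    filter_upwards [mem_nhdsWithin_of_mem_nhds (key α hα A hA),
      mem_nhdsWithin_of_mem_nhds (key β hβ B hB)] with t h1 h2 hPt
    obtain ⟨a', ha', e1⟩ := h1
    obtain ⟨b', hb', e2⟩ := h2
    exact (disjoint_left.mp hAB ha') (hPt _ _ e1 e2 ▸ hb')
  have hP0 : P 0 := fun α β hα hβ => by rw [h0] at hα hβ; rw [hα, hβ]
  intro t ht
  refine (isPreconnected_Icc.induction₂ (fun x y => P x ↔ P y) (fun x hx => ?_)
    (fun _ _ _ _ _ _ h h' => h.trans h') (fun _ _ _ _ h => h.symm)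
    (left_mem_Icc.mpr h₁) ht).mp hP0
  by_cases hx' : P x
  · filter_upwards [hpos x hx hx'] with z hz using iff_of_true hx' hz
  · filter_upwards [hneg x hx hx'] with z hz using iff_of_false hx' hz

theorem exists_inverse_flow (hX : ContDiff ℝ 1 X) {T : EReal} (h0 : ∀ α, X (0, α) = α)
    (hinj : ∀ t ∈ slab T, ∀ α k, fderiv ℝ (fun β => X (t, β)) α k = 0 → k = 0)
    (hC : ∀ t₁, ∃ C, ∀ t ∈ Icc 0 t₁, ∀ α, ‖X (t, α) - α‖ ≤ C) :
    ∃ Y : ℝ → E → E, (∀ t ∈ slab T, ∀ x, X (t, Y t x) = x) ∧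
      (∀ t ∈ slab T, ∀ α, Y t (X (t, α)) = α) ∧
      ContDiffOn ℝ 1 (Function.uncurry Y) (slab T ×ˢ univ) := by
  have hsub : ∀ t ∈ slab T, ∀ s ∈ Icc 0 t, s ∈ slab T := fun t ht s hs =>
    ⟨hs.1, lt_of_le_of_lt (by exact_mod_cast hs.2) ht.2⟩
  have hbij : ∀ t ∈ slab T, Function.Bijective fun α => X (t, α) := fun t ht => by
    obtain ⟨C, hC⟩ := hC t
    exact ⟨injective_of_bounded_displacement hX ht.1 h0 (fun s hs => hinj s (hsub t ht s hs)) hC,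
      surjective_of_bounded_displacement hX (hinj t ht) (hC t ⟨ht.1, le_rfl⟩)⟩
  have hY : ∀ t, ∃ y : E → E, t ∈ slab T → (∀ x, X (t, y x) = x) ∧ ∀ α, y (X (t, α)) = α := by
    intro t
    by_cases ht : t ∈ slab T
    · obtain ⟨y, h1, h2⟩ := Function.bijective_iff_has_inverse.mp (hbij t ht)
      exact ⟨y, fun _ => ⟨h2, h1⟩⟩
    · exact ⟨id, fun h => absurd h ht⟩
  choose Y hY using hY
  refine ⟨Y, fun t ht => (hY t ht).1, fun t ht => (hY t ht).2, ?_⟩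
  rintro ⟨t, x⟩ ⟨ht, -⟩
  obtain ⟨α, rfl⟩ := (hbij t ht).2 x
  simp only
  obtain ⟨L, hL⟩ := exists_equiv_hasStrictFDerivAt_graph hX (hinj t ht α)
  have hΦ : ContDiffAt ℝ 1 (fun p : ℝ × E => (p.1, X p)) (t, α) :=
    (contDiff_fst.prodMk hX).contDiffAt
  have hg := hΦ.to_localInverse hL.hasFDerivAt one_ne_zero
  have hinv : ∀ᶠ q in 𝓝 (t, X (t, α)), (fun p : ℝ × E => (p.1, X p))
      (hΦ.localInverse hL.hasFDerivAt one_ne_zero q) = q :=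
    (hΦ.hasStrictFDerivAt' hL.hasFDerivAt one_ne_zero).eventually_right_inverse
  refine ((contDiff_snd.contDiffAt.comp _ hg).contDiffWithinAt).congr_of_eventuallyEq ?_ ?_
  -- The C¹ local inverse agrees with Y on the slab, since Y undoes X there.
  · filter_upwards [self_mem_nhdsWithin, mem_nhdsWithin_of_mem_nhds hinv] with q hq hqi
    obtain ⟨s, z⟩ := q
    simp only [Prod.mk.injEq] at hqi
    set r := hΦ.localInverse hL.hasFDerivAt one_ne_zero (s, z)
    change Y s z = r.2
    rw [← hqi.2]
    have : r = (s, r.2) := by rw [← hqi.1]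
    rw [this]
    exact (hY s hq.1).2 _
  · have := hinv.self_of_nhds
    set r := hΦ.localInverse hL.hasFDerivAt one_ne_zero (t, X (t, α))
    simp only [Prod.mk.injEq] at this
    change Y t (X (t, α)) = r.2
    rw [← this.2]
    have h' : r = (t, r.2) := by rw [← this.1]
    rw [h']
    exact (hY t ht).2 _

end GlobalInverse

/-! ### The explicit velocity along a characteristic and its derivative. -/

section Velocity

variable {E : Type*} [NormedAddCommGroup E] [InnerProductSpace ℝ E]

/-- The radicand `a² (c² - |u|²) + |u|²` in the formula for the velocity along characteristics. -/
noncomputable def radicand (a c : ℝ) (u : E) : ℝ := a ^ 2 * (c ^ 2 - ‖u‖ ^ 2) + ‖u‖ ^ 2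

/-- The velocity, when the scale factor is `a`, of a particle whose initial velocity is `u`. -/
noncomputable def velocity (c a : ℝ) (u : E) : E := (c / √(radicand a c u)) • u

/-- The operator `η ↦ |u|² η - ⟪u, η⟫ u`. -/
noncomputable def perp (u : E) : E →L[ℝ] E :=
  ‖u‖ ^ 2 • ContinuousLinearMap.id ℝ E - (innerSL ℝ u).smulRight u

/-- The derivative of `velocity c a`. -/
noncomputable def velocityDeriv (c a : ℝ) (u : E) : E →L[ℝ] E :=
  (c ^ 3 * a ^ 2 / √(radicand a c u) ^ 3) • ContinuousLinearMap.id ℝ E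
    - (c * (a ^ 2 - 1) / √(radicand a c u) ^ 3) • perp u

theorem perp_apply (u η : E) : perp u η = ‖u‖ ^ 2 • η - inner ℝ u η • u := by
  simp [perp]

variable {a c : ℝ} {u : E}

omit [InnerProductSpace ℝ E] in
theorem sq_norm_lt (hu : ‖u‖ < c) : ‖u‖ ^ 2 < c ^ 2 :=
  pow_lt_pow_left₀ hu (norm_nonneg u) two_ne_zero

omit [InnerProductSpace ℝ E] in
theorem sq_norm_lt_radicand (ha : 0 < a) (hu : ‖u‖ < c) : ‖u‖ ^ 2 < radicand a c u := by
  have := sq_norm_lt hu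
  unfold radicand
  nlinarith [mul_pos (pow_pos ha 2) (sub_pos.2 this)]

omit [InnerProductSpace ℝ E] in
theorem radicand_pos (ha : 0 < a) (hu : ‖u‖ < c) : 0 < radicand a c u :=
  (sq_nonneg _).trans_lt (sq_norm_lt_radicand ha hu)

theorem velocity_one (hc : 0 < c) (u : E) : velocity c 1 u = u := by
  have : radicand 1 c u = c ^ 2 := by simp [radicand]
  rw [velocity, this, Real.sqrt_sq hc.le, div_self hc.ne', one_smul]

theorem norm_velocity_le (hc : 0 < c) (ha : 0 < a) (hu : ‖u‖ < c) : ‖velocity c a u‖ ≤ c := by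
  have h1 := radicand_pos ha hu
  have h2 : ‖u‖ ≤ √(radicand a c u) := Real.le_sqrt_of_sq_le (sq_norm_lt_radicand ha hu).le
  have h3 := Real.sqrt_pos.2 h1
  rw [velocity, norm_smul, Real.norm_of_nonneg (by positivity), div_mul_eq_mul_div, div_le_iff₀ h3]
  gcongr

theorem hasFDerivAt_velocity (ha : 0 < a) (hu : ‖u‖ < c) :
    HasFDerivAt (velocity c a) (velocityDeriv c a u) u := by
  have hr := radicand_pos ha hu
  have h3 := Real.sqrt_pos.2 hr
  have hn : HasFDerivAt (fun x : E => ‖x‖ ^ 2) (2 • innerSL ℝ u) u :=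
    (hasStrictFDerivAt_norm_sq u).hasFDerivAt
  have h4 : HasDerivAt (fun q : ℝ => a ^ 2 * (c ^ 2 - q) + q) (a ^ 2 * -1 + 1) (‖u‖ ^ 2) :=
    (((hasDerivAt_id _).const_sub (c ^ 2)).const_mul (a ^ 2)).add (hasDerivAt_id _)
  have h5 := (((h4.sqrt hr.ne').fun_inv h3.ne').const_mul c)
  have h7 := (h5.comp_hasFDerivAt u hn).smul (hasFDerivAt_id u)
  have h6 : (velocity c a : E → E) = ((fun q : ℝ => c * (√(a ^ 2 * (c ^ 2 - q) + q))⁻¹) ∘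
      fun x : E => ‖x‖ ^ 2) • id := by
    ext1 x; simp [velocity, radicand, div_eq_mul_inv]
  rw [h6]
  refine h7.congr_fderiv ?_
  have hsq : √(radicand a c u) ^ 2 = a ^ 2 * (c ^ 2 - ‖u‖ ^ 2) + ‖u‖ ^ 2 := Real.sq_sqrt hr.le
  change √(a ^ 2 * (c ^ 2 - ‖u‖ ^ 2) + ‖u‖ ^ 2) ^ 2 = _ at hsq
  change 0 < √(a ^ 2 * (c ^ 2 - ‖u‖ ^ 2) + ‖u‖ ^ 2) at h3
  ext1 η
  simp only [velocityDeriv, perp, Function.comp, radicand]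
  set ρ := √(a ^ 2 * (c ^ 2 - ‖u‖ ^ 2) + ‖u‖ ^ 2)
  have e1 : c * ρ⁻¹ = c ^ 3 * a ^ 2 / ρ ^ 3 - c * (a ^ 2 - 1) / ρ ^ 3 * ‖u‖ ^ 2 := by
    field_simp
    rw [hsq]; ring
  rw [e1]
  simp
  have e2 : c * (-((-a ^ 2 + 1) / (2 * ρ)) / ρ ^ 2) * (2 * inner ℝ u η) =
      c * (a ^ 2 - 1) / ρ ^ 3 * inner ℝ u η := by
    field_simp
    ring
  rw [e2]
  module

theorem continuous_velocity_comp {X : Type*} [TopologicalSpace X] {b : X → ℝ} {w : X → E}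
    (hb : Continuous b) (hw : Continuous w) (hb0 : ∀ x, 0 < b x) (hwc : ∀ x, ‖w x‖ < c) :
    Continuous fun x => velocity c (b x) (w x) := by
  have : ∀ x, √(radicand (b x) c (w x)) ≠ 0 := fun x =>
    (Real.sqrt_pos.2 (radicand_pos (hb0 x) (hwc x))).ne'
  unfold velocity
  unfold radicand at *
  fun_prop (disch := assumption)

theorem continuous_velocityDeriv_comp {X : Type*} [TopologicalSpace X] {b : X → ℝ} {w : X → E}
    (hb : Continuous b) (hw : Continuous w) (hb0 : ∀ x, 0 < b x) (hwc : ∀ x, ‖w x‖ < c) :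
    Continuous fun x => velocityDeriv c (b x) (w x) := by
  have : ∀ x, √(radicand (b x) c (w x)) ^ 3 ≠ 0 := fun x =>
    pow_ne_zero _ (Real.sqrt_pos.2 (radicand_pos (hb0 x) (hwc x))).ne'
  unfold velocityDeriv perp
  unfold radicand at *
  have h2 : Continuous fun x => (innerSL ℝ (w x)).smulRight (w x) := by
    have := ((ContinuousLinearMap.smulRightL ℝ E E).continuous₂).comp
      (((innerSL ℝ).continuous.comp hw).prodMk hw)
    exact this
  fun_prop (disch := assumption)

/-- Pairing with u kills the `perp` term and gives ⟪u, η⟫ = 0. On such η the derivative is a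
multiple of η, proportional to c²a² - (a² - 1)|u|², which is the positive radicand. -/
theorem velocityDeriv_injective (hc : 0 < c) (ha : 0 < a) (hu : ‖u‖ < c) {η : E}
    (h : velocityDeriv c a u η = 0) : η = 0 := by
  have hr := radicand_pos ha hu
  have h3 := Real.sqrt_pos.2 hr
  have hsq : √(radicand a c u) ^ 2 = a ^ 2 * (c ^ 2 - ‖u‖ ^ 2) + ‖u‖ ^ 2 := Real.sq_sqrt hr.le
  set ρ := √(radicand a c u) with hρ
  have h4 : (c ^ 2 * a ^ 2) • η = (a ^ 2 - 1) • (‖u‖ ^ 2 • η - inner ℝ u η • u) := by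
    have : velocityDeriv c a u η = (c / ρ ^ 3) • ((c ^ 2 * a ^ 2) • η
        - (a ^ 2 - 1) • (‖u‖ ^ 2 • η - inner ℝ u η • u)) := by
      simp only [velocityDeriv, perp, ← hρ]
      simp
      module
    rw [this, smul_eq_zero_iff_right (by positivity)] at h
    exact sub_eq_zero.1 h
  have h5 : inner ℝ u η = 0 := by
    have := congrArg (fun z => inner ℝ u z) h4
    simp only [inner_smul_right, inner_sub_right, real_inner_self_eq_norm_sq] at this
    have h6 : c ^ 2 * a ^ 2 * inner ℝ u η = 0 := by rw [this]; ring
    simpa [hc.ne', ha.ne'] using h6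
  rw [h5, zero_smul, sub_zero, smul_smul, ← sub_eq_zero, ← sub_smul] at h4
  have h7 : c ^ 2 * a ^ 2 - (a ^ 2 - 1) * ‖u‖ ^ 2 = ρ ^ 2 := by rw [hsq]; ring
  rw [h7] at h4
  exact (smul_eq_zero_iff_right (by positivity)).1 h4

/-- The velocity solves the ordinary differential equation along characteristics. -/
theorem hasDerivWithinAt_velocity {b : ℝ → ℝ} {b' t : ℝ} {s : Set ℝ} (hc : 0 < c)
    (hb : HasDerivWithinAt b b' s t) (hb0 : 0 < b t) (hu : ‖u‖ < c) :
    HasDerivWithinAt (fun τ => velocity c (b τ) u)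
      (-(b' / b t * (1 - ‖velocity c (b t) u‖ ^ 2 / c ^ 2)) • velocity c (b t) u) s t := by
  have hr := radicand_pos hb0 hu
  have h3 := Real.sqrt_pos.2 hr
  have h4 : HasDerivWithinAt (fun τ => radicand (b τ) c u)
      (2 * b t * b' * (c ^ 2 - ‖u‖ ^ 2)) s t := by
    simpa [radicand] using ((hb.pow 2).mul_const (c ^ 2 - ‖u‖ ^ 2)).add_const (‖u‖ ^ 2)
  have h5 := ((h4.sqrt hr.ne').fun_inv h3.ne').const_mul c |>.smul_const u
  have h6 : (fun τ => velocity c (b τ) u) = fun τ => (c * (√(radicand (b τ) c u))⁻¹) • u := by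
    ext1 x; simp [velocity, div_eq_mul_inv]
  rw [h6]
  refine h5.congr_deriv ?_
  have hsq : √(radicand (b t) c u) ^ 2 = b t ^ 2 * (c ^ 2 - ‖u‖ ^ 2) + ‖u‖ ^ 2 := Real.sq_sqrt hr.le
  simp only [velocity, norm_smul, smul_smul, Real.norm_eq_abs]
  set ρ := √(radicand (b t) c u)
  congr 1
  rw [mul_pow, sq_abs]
  field_simp
  have : ‖u‖ ^ 2 = ρ ^ 2 - b t ^ 2 * (c ^ 2 - ‖u‖ ^ 2) := by rw [hsq]; ring
  linear_combination (-b') * this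

end Velocity

/-! ### The characteristic flow, its derivative and its displacement. -/

section Flow

variable {E : Type*} [NormedAddCommGroup E] [InnerProductSpace ℝ E] [FiniteDimensional ℝ E]

/-- The characteristic flow with scale factor `a` and initial velocity field `w`. -/
noncomputable def flow (a : ℝ → ℝ) (c : ℝ) (w : E → E) (p : ℝ × E) : E :=
  p.2 + ∫ s in (0 : ℝ)..p.1, (a s)⁻¹ • velocity c (a s) (w p.2)

/-- The coefficient of `∂w/∂α` in the characteristic Jacobian. -/
noncomputable def mainCoeff (a : ℝ → ℝ) (c : ℝ) (u : E) (t : ℝ) : ℝ :=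
  ∫ s in (0 : ℝ)..t, c ^ 3 * a s / √(radicand (a s) c u) ^ 3

/-- The coefficient of `(|w|² I - wᵀ w) ∂w/∂α` in the characteristic Jacobian. -/
noncomputable def perpCoeff (a : ℝ → ℝ) (c : ℝ) (u : E) (t : ℝ) : ℝ :=
  ∫ s in (0 : ℝ)..t, c * (a s - (a s)⁻¹) / √(radicand (a s) c u) ^ 3

/-- The spatial derivative of the characteristic flow. -/
noncomputable def flowDeriv (a : ℝ → ℝ) (c : ℝ) (w : E → E) (t : ℝ) (α : E) : E →L[ℝ] E :=
  ContinuousLinearMap.id ℝ E + mainCoeff a c (w α) t • fderiv ℝ w α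
    - perpCoeff a c (w α) t • (perp (w α)).comp (fderiv ℝ w α)

variable {a : ℝ → ℝ} {c : ℝ} {w : E → E}

omit [FiniteDimensional ℝ E] in
theorem flow_zero (α : E) : flow a c w (0, α) = α := by simp [flow]

section

omit [InnerProductSpace ℝ E] [FiniteDimensional ℝ E]
variable (hac : Continuous a) (ha : ∀ s, 0 < a s) {u : E} (hu : ‖u‖ < c)
include hac ha hu

theorem continuous_mainCoeff_integrand :
    Continuous fun s => c ^ 3 * a s / √(radicand (a s) c u) ^ 3 := by
  have h : ∀ s, √(radicand (a s) c u) ^ 3 ≠ 0 := fun s =>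
    pow_ne_zero _ (Real.sqrt_pos.2 (radicand_pos (ha s) hu)).ne'
  unfold radicand at *
  fun_prop (disch := assumption)

theorem continuous_perpCoeff_integrand :
    Continuous fun s => c * (a s - (a s)⁻¹) / √(radicand (a s) c u) ^ 3 := by
  have h : ∀ s, √(radicand (a s) c u) ^ 3 ≠ 0 := fun s =>
    pow_ne_zero _ (Real.sqrt_pos.2 (radicand_pos (ha s) hu)).ne'
  have h' : ∀ s, a s ≠ 0 := fun s => (ha s).ne'
  unfold radicand at *
  fun_prop (disch := assumption)

end

variable (hac : Continuous a) (ha : ∀ s, 0 < a s) (hw : ContDiff ℝ 1 w) (hwc : ∀ α, ‖w α‖ < c)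
include hac ha hw hwc

theorem contDiff_flow_and_hasFDerivAt : ContDiff ℝ 1 (flow a c w) ∧
    ∀ t α, HasFDerivAt (fun β => flow a c w (t, β)) (flowDeriv a c w t α) α := by
  have hw' : Continuous (fderiv ℝ w) := hw.continuous_fderiv one_ne_zero
  have hne : ∀ s, a s ≠ 0 := fun s => (ha s).ne'
  have hf : Continuous (Function.uncurry fun s α => (a s)⁻¹ • velocity c (a s) (w α)) := by
    have h1 : Continuous fun p : ℝ × E => velocity c (a p.1) (w p.2) :=
      continuous_velocity_comp (hac.comp continuous_fst) (hw.continuous.comp continuous_snd)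
        (fun p => ha p.1) (fun p => hwc p.2)
    exact ((hac.inv₀ hne).comp continuous_fst).smul h1
  have hf' : Continuous (Function.uncurry fun s α =>
      (a s)⁻¹ • (velocityDeriv c (a s) (w α)).comp (fderiv ℝ w α)) := by
    have h1 : Continuous fun p : ℝ × E => velocityDeriv c (a p.1) (w p.2) :=
      continuous_velocityDeriv_comp (hac.comp continuous_fst) (hw.continuous.comp continuous_snd)
        (fun p => ha p.1) (fun p => hwc p.2)
    exact ((hac.inv₀ hne).comp continuous_fst).smul (h1.clm_comp (hw'.comp continuous_snd))
  have hd : ∀ s α, HasFDerivAt (fun α => (a s)⁻¹ • velocity c (a s) (w α))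
      ((a s)⁻¹ • (velocityDeriv c (a s) (w α)).comp (fderiv ℝ w α)) α := fun s α =>
    ((hasFDerivAt_velocity (ha s) (hwc α)).comp α
      (hw.differentiable one_ne_zero α).hasFDerivAt).const_smul _
  refine ⟨contDiff_snd.add (contDiff_intervalIntegral_param hf hf' hd), fun t α => ?_⟩
  refine ((hasFDerivAt_id α).add (hasFDerivAt_intervalIntegral_param hf hf' hd t α)).congr_fderiv ?_
  rw [flowDeriv, add_sub_assoc]
  congr 1
  rw [mainCoeff, perpCoeff]
  refine Eq.trans ?_ (congrArg₂ (· - ·)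
    (intervalIntegral.integral_smul_const (𝕜 := ℝ) _ (fderiv ℝ w α))
    (intervalIntegral.integral_smul_const (𝕜 := ℝ) _ ((perp (w α)).comp (fderiv ℝ w α))))
  rw [← intervalIntegral.integral_sub]
  · refine intervalIntegral.integral_congr fun s _ => ?_
    simp only [velocityDeriv, ContinuousLinearMap.sub_comp, ContinuousLinearMap.smul_comp,
      ContinuousLinearMap.id_comp, smul_sub, smul_smul]
    have := hne s
    congr 2 <;> field_simp
  · exact ((continuous_mainCoeff_integrand hac ha (hwc α)).smul continuous_const).intervalIntegrable _ _
  · exact ((continuous_perpCoeff_integrand hac ha (hwc α)).smul continuous_const).intervalIntegrable _ _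

omit hw in
theorem hasDerivAt_flow (t : ℝ) (α : E) : HasDerivAt (fun s => flow a c w (s, α))
    ((a t)⁻¹ • velocity c (a t) (w α)) t := by
  have h1 : Continuous fun s => (a s)⁻¹ • velocity c (a s) (w α) :=
    (hac.inv₀ fun s => (ha s).ne').smul
      (continuous_velocity_comp hac continuous_const ha fun _ => hwc α)
  exact (intervalIntegral.integral_hasDerivAt_right (h1.intervalIntegrable _ _)
    (h1.stronglyMeasurableAtFilter _ _) h1.continuousAt).const_add α

omit hw [FiniteDimensional ℝ E] in
-- The speed never exceeds c/a, whatever α is; this uniformity supplies the properness needed for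
-- global inversion.
theorem exists_norm_flow_sub_le (hc : 0 < c) (t₁ : ℝ) :
    ∃ C, ∀ t ∈ Icc 0 t₁, ∀ α, ‖flow a c w (t, α) - α‖ ≤ C := by
  obtain ⟨M, hM⟩ := (isCompact_Icc (a := (0 : ℝ)) (b := t₁)).exists_bound_of_continuousOn
    (hac.inv₀ fun s => (ha s).ne').continuousOn
  refine ⟨M * c * t₁, fun t ht α => ?_⟩
  have hM0 : 0 ≤ M := (norm_nonneg _).trans (hM 0 ⟨le_rfl, ht.1.trans ht.2⟩)
  simp only [flow, add_sub_cancel_left]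
  have := intervalIntegral.norm_integral_le_of_norm_le_const (a := 0) (b := t) (C := M * c)
    (f := fun s => (a s)⁻¹ • velocity c (a s) (w α)) fun s hs => by
      rw [uIoc_of_le ht.1] at hs
      rw [norm_smul]
      exact mul_le_mul (hM s ⟨hs.1.le, hs.2.trans ht.2⟩) (norm_velocity_le hc (ha s) (hwc α))
        (norm_nonneg _) hM0
  refine this.trans ?_
  rw [sub_zero, abs_of_nonneg ht.1]
  exact mul_le_mul_of_nonneg_left ht.2 (by positivity)

end Flow

/-! ### Differential calculus on the slab [0, T) × F. -/

section Slab

variable {T : EReal} {t : ℝ}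

theorem mem_slab_of_mem_Icc (ht : t ∈ slab T) {s : ℝ} (hs : s ∈ Icc 0 t) : s ∈ slab T :=
  ⟨hs.1, lt_of_le_of_lt (by exact_mod_cast hs.2) ht.2⟩

theorem isOpen_coe_lt (T : EReal) : IsOpen {s : ℝ | (s : EReal) < T} :=
  isOpen_Iio.preimage continuous_coe_real_ereal

theorem nhdsWithin_slab (ht : t ∈ slab T) : 𝓝[slab T] t = 𝓝[Ici 0] t :=
  nhdsWithin_inter_of_mem' (s := Ici (0 : ℝ)) (mem_nhdsWithin_of_mem_nhds ((isOpen_coe_lt T).mem_nhds ht.2))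

theorem uniqueDiffOn_slab (T : EReal) : UniqueDiffOn ℝ (slab T) :=
  (uniqueDiffOn_Ici (0 : ℝ)).inter (isOpen_coe_lt T)

variable {F G : Type*} [NormedAddCommGroup F] [NormedSpace ℝ F] [NormedAddCommGroup G]
  [NormedSpace ℝ G] {v : ℝ → F → G}

/-- The space-time derivative on the slab `[0, T) × F`. -/
noncomputable def slabDeriv (T : EReal) (v : ℝ → F → G) (p : ℝ × F) : ℝ × F →L[ℝ] G :=
  fderivWithin ℝ (Function.uncurry v) (slab T ×ˢ univ) p

theorem continuousOn_slabDeriv (hv : ContDiffOn ℝ 1 (Function.uncurry v) (slab T ×ˢ univ)) :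
    ContinuousOn (slabDeriv T v) (slab T ×ˢ univ) :=
  hv.continuousOn_fderivWithin ((uniqueDiffOn_slab T).prod uniqueDiffOn_univ) le_rfl

/-- At a time of the slab, [0, T) and [0, ∞) have the same neighbourhood filter, so the chain rule
on the slab also yields the one-sided derivative at t = 0. -/
theorem hasDerivWithinAt_along (hv : ContDiffOn ℝ 1 (Function.uncurry v) (slab T ×ˢ univ))
    (ht : t ∈ slab T) {γ : ℝ → F} {γ' : F} (hγ : HasDerivWithinAt γ γ' (Ici 0) t) :
    HasDerivWithinAt (fun s => v s (γ s)) (slabDeriv T v (t, γ t) (1, γ')) (Ici 0) t := by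
  have h1 : HasFDerivWithinAt (Function.uncurry v) (slabDeriv T v (t, γ t)) (slab T ×ˢ univ)
      (t, γ t) :=
    (hv.differentiableOn one_ne_zero _ ⟨ht, trivial⟩).hasFDerivWithinAt
  have h2 : HasDerivWithinAt γ γ' (slab T) t := hγ.mono fun s hs => hs.1
  have h3 : HasDerivWithinAt (fun s => (s, γ s)) (1, γ') (slab T) t :=
    (hasDerivWithinAt_id t _).prodMk h2
  have h4 := h1.comp_hasDerivWithinAt t h3 fun s hs => mk_mem_prod hs (mem_univ _)
  rw [HasDerivWithinAt, HasDerivAtFilter, ← nhdsWithin_slab ht]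
  exact h4

theorem hasDerivWithinAt_time (hv : ContDiffOn ℝ 1 (Function.uncurry v) (slab T ×ˢ univ))
    (ht : t ∈ slab T) (x : F) :
    HasDerivWithinAt (fun s => v s x) (slabDeriv T v (t, x) (1, 0)) (Ici 0) t :=
  hasDerivWithinAt_along hv ht (hasDerivWithinAt_const _ _ x)

theorem hasFDerivAt_space (hv : ContDiffOn ℝ 1 (Function.uncurry v) (slab T ×ˢ univ))
    (ht : t ∈ slab T) (x : F) :
    HasFDerivAt (v t) ((slabDeriv T v (t, x)).comp (ContinuousLinearMap.inr ℝ ℝ F)) x := by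
  have h1 : HasFDerivWithinAt (Function.uncurry v) (slabDeriv T v (t, x)) (slab T ×ˢ univ)
      (t, x) :=
    (hv.differentiableOn one_ne_zero _ ⟨ht, trivial⟩).hasFDerivWithinAt
  rw [← hasFDerivWithinAt_univ]
  exact h1.comp x (hasFDerivAt_prodMk_right t x).hasFDerivWithinAt fun y _ => ⟨ht, trivial⟩

theorem slabDeriv_apply (L : ℝ × F →L[ℝ] G) (k : F) : L (1, k) = L (1, 0) + L (0, k) := by
  rw [← map_add]; simp

end Slab

/-! ### The vector form of the equation; solutions and characteristics. -/

section Equation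

variable {n : ℕ} {a : ℝ → ℝ} {c : ℝ}

theorem sum_jac_mul (w : EuclideanSpace ℝ (Fin n) → EuclideanSpace ℝ (Fin n)) (x ξ : EuclideanSpace ℝ (Fin n)) (i : Fin n) :
    ∑ j, jac w x i j * ξ j = fderiv ℝ w x ξ i := by
  have h : ξ = ∑ j, ξ j • EuclideanSpace.single j (1 : ℝ) := by
    ext k
    simp [Finset.sum_apply, Pi.single_apply]
  conv_rhs => rw [h]
  simp [jac, mul_comm]

theorem equation_iff {v : ℝ → EuclideanSpace ℝ (Fin n) → EuclideanSpace ℝ (Fin n)} {t : ℝ} {x : EuclideanSpace ℝ (Fin n)}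
    (hd : DifferentiableWithinAt ℝ (fun s => v s x) (Ici 0) t) (ht : 0 ≤ t) :
    (∀ i, derivWithin (fun s => v s x i) (Ici 0) t
      + ∑ j, v t x j / a t * jac (v t) x i j
      + dot a t / a t * v t x i
      - dot a t / a t * (‖v t x‖ ^ 2 / c ^ 2) * v t x i = 0) ↔
    derivWithin (fun s => v s x) (Ici 0) t + (a t)⁻¹ • fderiv ℝ (v t) x (v t x)
      + (dot a t / a t * (1 - ‖v t x‖ ^ 2 / c ^ 2)) • v t x = 0 := by
  have h1 : ∀ i, derivWithin (fun s => v s x i) (Ici 0) t =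
      (derivWithin (fun s => v s x) (Ici 0) t) i := fun i =>
    (((EuclideanSpace.proj i : EuclideanSpace ℝ (Fin n) →L[ℝ] ℝ).hasFDerivAt.comp_hasDerivWithinAt t
      hd.hasDerivWithinAt).derivWithin (uniqueDiffOn_Ici 0 t ht))
  have h2 : ∀ i, ∑ j, v t x j / a t * jac (v t) x i j =
      (a t)⁻¹ * fderiv ℝ (v t) x (v t x) i := fun i => by
    rw [← sum_jac_mul, Finset.mul_sum]
    exact Finset.sum_congr rfl fun j _ => by ring
  constructor
  · intro h
    ext i
    have := h i
    rw [h1, h2] at this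
    simp
    linarith
  · intro h i
    have := congrArg (fun z : EuclideanSpace ℝ (Fin n) => z i) h
    simp at this
    rw [h1, h2]
    linarith

/-- The Lipschitz constant of the friction term on a ball, for the Grönwall estimate. -/
theorem norm_friction_sub_le {M : ℝ} {y z : EuclideanSpace ℝ (Fin n)} (hy : ‖y‖ ≤ M) (hz : ‖z‖ ≤ M) :
    ‖(1 - ‖y‖ ^ 2 / c ^ 2) • y - (1 - ‖z‖ ^ 2 / c ^ 2) • z‖ ≤ (1 + 3 * M ^ 2 / c ^ 2) * ‖y - z‖ := by
  have h1 : (1 - ‖y‖ ^ 2 / c ^ 2) • y - (1 - ‖z‖ ^ 2 / c ^ 2) • z =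
      (1 - ‖y‖ ^ 2 / c ^ 2) • (y - z) - ((‖y‖ - ‖z‖) * (‖y‖ + ‖z‖) / c ^ 2) • z := by
    rw [smul_sub, sub_sub, ← add_smul]
    congr 2
    ring
  rw [h1]
  have hM : 0 ≤ M := (norm_nonneg _).trans hy
  have h2 : |1 - ‖y‖ ^ 2 / c ^ 2| ≤ 1 + M ^ 2 / c ^ 2 := by
    refine (abs_sub _ _).trans ?_
    rw [abs_one, abs_of_nonneg (by positivity)]
    gcongr
  have h3 : |(‖y‖ - ‖z‖) * (‖y‖ + ‖z‖) / c ^ 2| ≤ ‖y - z‖ * (2 * M) / c ^ 2 := by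
    rw [abs_div, abs_mul, abs_of_nonneg (by positivity : 0 ≤ c ^ 2),
      abs_of_nonneg (by positivity : 0 ≤ ‖y‖ + ‖z‖)]
    gcongr
    · exact abs_norm_sub_norm_le y z
    · linarith
  refine (norm_sub_le _ _).trans ?_
  rw [norm_smul, norm_smul, Real.norm_eq_abs, Real.norm_eq_abs]
  calc _ ≤ (1 + M ^ 2 / c ^ 2) * ‖y - z‖ + ‖y - z‖ * (2 * M) / c ^ 2 * M := by gcongr
    _ = _ := by ring

theorem IsScaleFactor.hasDerivWithinAt (ha : IsScaleFactor a) {t : ℝ} (ht : 0 ≤ t) :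
    HasDerivWithinAt a (dot a t) (Ici 0) t :=
  (ha.contDiffOn.differentiableOn two_ne_zero t ht).hasDerivWithinAt

theorem IsScaleFactor.continuousOn_dot (ha : IsScaleFactor a) : ContinuousOn (dot a) (Ici 0) :=
  ha.contDiffOn.continuousOn_derivWithin (uniqueDiffOn_Ici 0) (by norm_num)

variable {w : EuclideanSpace ℝ (Fin n) → EuclideanSpace ℝ (Fin n)} {T : EReal} {v : ℝ → EuclideanSpace ℝ (Fin n) → EuclideanSpace ℝ (Fin n)}

theorem IsClassicalSolution.vector_equation (hv : IsClassicalSolution a c w T v) {t : ℝ}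
    (ht : t ∈ slab T) (x : EuclideanSpace ℝ (Fin n)) :
    slabDeriv T v (t, x) (1, 0) + (a t)⁻¹ • slabDeriv T v (t, x) (0, v t x)
      + (dot a t / a t * (1 - ‖v t x‖ ^ 2 / c ^ 2)) • v t x = 0 := by
  have h1 := hasDerivWithinAt_time hv.contDiffOn ht x
  have := (equation_iff h1.differentiableWithinAt ht.1).1 (hv.equation t ht.1 ht.2 x)
  rw [h1.derivWithin (uniqueDiffOn_Ici 0 t ht.1), (hasFDerivAt_space hv.contDiffOn ht x).fderiv]
    at this
  simpa using this

section Global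

variable (hc : 0 < c) (ha : IsScaleFactor a) (hac : Continuous a) (hpos : ∀ s, 0 < a s)
  (hwc : ∀ α, ‖w α‖ < c)
include hc ha hac hpos hwc

/-- A classical solution is transported along the explicit characteristics. -/
theorem IsClassicalSolution.apply_flow (hv : IsClassicalSolution a c w T v) {t : ℝ}
    (ht : t ∈ slab T) (α : EuclideanSpace ℝ (Fin n)) : v t (flow a c w (t, α)) = velocity c (a t) (w α) := by
  set γ : ℝ → EuclideanSpace ℝ (Fin n) := fun s => flow a c w (s, α) with hγdef
  set W : ℝ → EuclideanSpace ℝ (Fin n) := fun s => velocity c (a s) (w α) with hWdef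
  have hγ : ∀ s, HasDerivAt γ ((a s)⁻¹ • W s) s := fun s => hasDerivAt_flow hac hpos hwc s α
  have hγc : Continuous γ := continuous_iff_continuousAt.2 fun s => (hγ s).continuousAt
  have hsub : ∀ s ∈ Icc 0 t, s ∈ slab T := fun s hs => mem_slab_of_mem_Icc ht hs
  have hvd : ∀ s ∈ Icc 0 t, HasDerivWithinAt (fun r => v r (γ r))
      (slabDeriv T v (s, γ s) (1, (a s)⁻¹ • W s)) (Ici 0) s := fun s hs =>
    hasDerivWithinAt_along hv.contDiffOn (hsub s hs) (hγ s).hasDerivWithinAt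
  have hWd : ∀ s ∈ Icc 0 t, HasDerivWithinAt W
      (-(dot a s / a s * (1 - ‖W s‖ ^ 2 / c ^ 2)) • W s) (Ici 0) s := fun s hs =>
    hasDerivWithinAt_velocity hc (ha.hasDerivWithinAt hs.1) (hpos s) (hwc α)
  have hzd := fun s hs => (hvd s hs).sub (hWd s hs)
  have hmaps : MapsTo (fun s => (s, γ s)) (Icc 0 t) (slab T ×ˢ univ) :=
    fun s hs => ⟨hsub s hs, trivial⟩
  have hpc : Continuous fun s => (s, γ s) := by fun_prop
  obtain ⟨M₁, hM₁⟩ := (isCompact_Icc (a := (0 : ℝ)) (b := t)).exists_bound_of_continuousOn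
    ((continuousOn_slabDeriv hv.contDiffOn).comp hpc.continuousOn hmaps)
  obtain ⟨M₂, hM₂⟩ := (isCompact_Icc (a := (0 : ℝ)) (b := t)).exists_bound_of_continuousOn
    (hv.contDiffOn.continuousOn.comp hpc.continuousOn hmaps)
  obtain ⟨M₃, hM₃⟩ := (isCompact_Icc (a := (0 : ℝ)) (b := t)).exists_bound_of_continuousOn
    ((ha.continuousOn_dot.mono Icc_subset_Ici_self).div hac.continuousOn fun s _ => (hpos s).ne')
  obtain ⟨M₄, hM₄⟩ := (isCompact_Icc (a := (0 : ℝ)) (b := t)).exists_bound_of_continuousOn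
    (hac.inv₀ fun s => (hpos s).ne').continuousOn
  set M := max M₂ c
  have key := eq_zero_of_abs_deriv_le_mul_abs_self_of_eq_zero_right (a := 0) (b := t)
    (K := M₄ * M₁ + M₃ * (1 + 3 * M ^ 2 / c ^ 2))
    (fun s hs => ((hzd s hs).mono Icc_subset_Ici_self).continuousWithinAt)
    (fun s hs => (hzd s (Ico_subset_Icc_self hs)).mono (Ici_subset_Ici.2 hs.1)) ?_ ?_ t
    ⟨ht.1, le_rfl⟩
  · exact sub_eq_zero.1 key
  · have h0 : γ 0 = α := flow_zero α
    have hT : 0 < T := lt_of_le_of_lt (by exact_mod_cast ht.1) ht.2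
    simp only [Pi.sub_apply, h0, hv.init hT, hWdef, ha.init, velocity_one hc, sub_self]
  · intro s hs
    have hs' := Ico_subset_Icc_self hs
    have heq := hv.vector_equation (hsub s hs') (γ s)
    have h1 := hM₁ s hs'
    have h2 : ‖v s (γ s)‖ ≤ M := (hM₂ s hs').trans (le_max_left _ _)
    have h3 := hM₃ s hs'
    have h4 := hM₄ s hs'
    have h5 : ‖W s‖ ≤ M := (norm_velocity_le hc (hpos s) (hwc α)).trans (le_max_right _ _)
    simp only [Pi.sub_apply, Function.comp] at h1 h3 h4 ⊢
    set D := slabDeriv T v (s, γ s)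
    set y := v s (γ s)
    -- The curve moves with velocity W/a, not v/a. Eliminating the time derivative by the equation
    -- leaves only terms that vanish when v = W, so uniqueness of the characteristics of v is not
    -- needed.
    have e1 : D (1, (a s)⁻¹ • W s) - -(dot a s / a s * (1 - ‖W s‖ ^ 2 / c ^ 2)) • W s =
        -((a s)⁻¹ • D (0, y - W s)) - (dot a s / a s) •
          ((1 - ‖y‖ ^ 2 / c ^ 2) • y - (1 - ‖W s‖ ^ 2 / c ^ 2) • W s) := by
      have e2 : D (1, (a s)⁻¹ • W s) = D (1, 0) + (a s)⁻¹ • D (0, W s) := by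
        rw [slabDeriv_apply, ← map_smul]; simp
      have e3 : D (0, y - W s) = D (0, y) - D (0, W s) := by rw [← map_sub]; simp
      rw [e2, e3, eq_sub_of_add_eq (eq_neg_of_add_eq_zero_left heq) ]
      module
    rw [e1]
    have h6 : ‖D (0, y - W s)‖ ≤ M₁ * ‖y - W s‖ := by
      refine (D.le_opNorm _).trans ?_
      rw [Prod.norm_mk, norm_zero, max_eq_right (norm_nonneg _)]
      gcongr
    refine (norm_sub_le _ _).trans ?_
    rw [norm_neg, norm_smul, norm_smul, add_mul, mul_assoc, mul_assoc]
    have hM₄0 : 0 ≤ M₄ := (norm_nonneg _).trans h4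
    have hM₃0 : 0 ≤ M₃ := (norm_nonneg _).trans h3
    exact add_le_add (mul_le_mul h4 h6 (norm_nonneg _) hM₄0)
      (mul_le_mul h3 (norm_friction_sub_le h2 h5) (norm_nonneg _) hM₃0)

variable (hw : ContDiff ℝ 1 w)
include hw

theorem IsClassicalSolution.fderiv_comp_flowDeriv (hv : IsClassicalSolution a c w T v) {t : ℝ}
    (ht : t ∈ slab T) (α : EuclideanSpace ℝ (Fin n)) :
    (fderiv ℝ (v t) (flow a c w (t, α))).comp (flowDeriv a c w t α) =
      (velocityDeriv c (a t) (w α)).comp (fderiv ℝ w α) := by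
  have h1 := (hasFDerivAt_space hv.contDiffOn ht (flow a c w (t, α))).differentiableAt.hasFDerivAt
  have h2 := h1.comp α ((contDiff_flow_and_hasFDerivAt hac hpos hw hwc).2 t α)
  have h3 := (hasFDerivAt_velocity (c := c) (hpos t) (hwc α)).comp α
    (hw.differentiable one_ne_zero α).hasFDerivAt
  refine h2.unique (h3.congr_of_eventuallyEq (Eventually.of_forall fun β => ?_))
  exact hv.apply_flow hc ha hac hpos hwc ht β

/-- A kernel vector of DX is killed by Dw, as the velocity derivative is injective; but on the
kernel of Dw the map DX is the identity. -/
theorem IsClassicalSolution.flowDeriv_injective (hv : IsClassicalSolution a c w T v) {t : ℝ}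
    (ht : t ∈ slab T) (α k : EuclideanSpace ℝ (Fin n)) (hk : flowDeriv a c w t α k = 0) : k = 0 := by
  have h1 := DFunLike.congr_fun (hv.fderiv_comp_flowDeriv hc ha hac hpos hwc hw ht α) k
  simp only [ContinuousLinearMap.comp_apply, hk, map_zero] at h1
  have h2 := velocityDeriv_injective hc (hpos t) (hwc α) h1.symm
  simpa [flowDeriv, h2] using hk

theorem exists_isClassicalSolution
    (hinj : ∀ t ∈ slab T, ∀ α k, flowDeriv a c w t α k = 0 → k = 0) :
    ∃ v, IsClassicalSolution a c w T v := by
  obtain ⟨hX, hD⟩ := contDiff_flow_and_hasFDerivAt hac hpos hw hwc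
  obtain ⟨Y, hXY, hYX, hY⟩ := exists_inverse_flow (T := T) hX flow_zero
    (fun t ht α k hk => hinj t ht α k (by rwa [(hD t α).fderiv] at hk))
    (exists_norm_flow_sub_le hac hpos hwc hc)
  let v : ℝ → EuclideanSpace ℝ (Fin n) → EuclideanSpace ℝ (Fin n) := fun t x => velocity c (a t) (w (Y t x))
  have hvc : ContDiffOn ℝ 1 (Function.uncurry v) (slab T ×ˢ univ) := by
    have h1 : ContDiffOn ℝ 1 (fun p : ℝ × EuclideanSpace ℝ (Fin n) => a p.1) (slab T ×ˢ univ) :=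
      (ha.contDiffOn.of_le (by norm_num)).comp contDiffOn_fst fun p hp => hp.1.1
    have h2 : ContDiffOn ℝ 1 (fun p : ℝ × EuclideanSpace ℝ (Fin n) => w (Y p.1 p.2)) (slab T ×ˢ univ) :=
      hw.comp_contDiffOn hY
    have h3 : ContDiffOn ℝ 1 (fun p : ℝ × EuclideanSpace ℝ (Fin n) => ‖w (Y p.1 p.2)‖ ^ 2) (slab T ×ˢ univ) := h2.norm_sq ℝ
    have h4 : ContDiffOn ℝ 1 (fun p : ℝ × EuclideanSpace ℝ (Fin n) => radicand (a p.1) c (w (Y p.1 p.2)))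
        (slab T ×ˢ univ) := ((h1.pow 2).mul (contDiffOn_const.sub h3)).add h3
    have h5 := fun p : ℝ × EuclideanSpace ℝ (Fin n) => radicand_pos (hpos p.1) (hwc (Y p.1 p.2))
    exact (contDiffOn_const.div (h4.sqrt fun p _ => (h5 p).ne')
      fun p _ => (Real.sqrt_pos.2 (h5 p)).ne').smul h2
  refine ⟨v, hvc, fun t h0 hT x => ?_, fun hT x => ?_⟩
  · have ht : t ∈ slab T := ⟨h0, hT⟩
    have h1 := hasDerivWithinAt_time hvc ht x
    rw [equation_iff h1.differentiableWithinAt h0, h1.derivWithin (uniqueDiffOn_Ici 0 t h0),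
      (hasFDerivAt_space hvc ht x).fderiv]
    set α := Y t x
    have hx : flow a c w (t, α) = x := hXY t ht x
    have h2 := hasDerivWithinAt_along hvc ht
      (hasDerivAt_flow hac hpos hwc t α).hasDerivWithinAt
    have h3 := hasDerivWithinAt_velocity hc (ha.hasDerivWithinAt h0) (hpos t) (hwc α)
    -- Two values for the derivative of v along the characteristic: the chain rule and the ordinary
    -- differential equation of W.
    have h4 := (uniqueDiffOn_Ici (0 : ℝ) t h0).eq_deriv _ h2 (h3.congr_of_eventuallyEq ?_ ?_)
    · rw [hx, slabDeriv_apply] at h4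
      have h5 : slabDeriv T v (t, x) (0, (a t)⁻¹ • velocity c (a t) (w α)) =
          (a t)⁻¹ • slabDeriv T v (t, x) (0, velocity c (a t) (w α)) := by
        rw [← map_smul]; simp
      rw [h5] at h4
      change slabDeriv T v (t, x) (1, 0) + (a t)⁻¹ • slabDeriv T v (t, x) (0, velocity c (a t) (w α))
        + (dot a t / a t * (1 - ‖velocity c (a t) (w α)‖ ^ 2 / c ^ 2)) • velocity c (a t) (w α) = 0
      rw [h4, neg_smul, neg_add_cancel]
    · rw [← nhdsWithin_slab ht]
      filter_upwards [self_mem_nhdsWithin] with s hs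
      change velocity c (a s) (w (Y s (flow a c w (s, α)))) = _
      rw [hYX s hs]
    · change velocity c (a t) (w (Y t (flow a c w (t, α)))) = _
      rw [hYX t ht]
  · have ht : (0 : ℝ) ∈ slab T := ⟨le_rfl, by exact_mod_cast hT⟩
    have := hYX 0 ht x
    rw [flow_zero] at this
    change velocity c (a 0) (w (Y 0 x)) = w x
    rw [this, ha.init, velocity_one hc]

end Global

end Equation

section

variable {n : ℕ} {a : ℝ → ℝ} {c ε : ℝ}
  {v₀ : EuclideanSpace ℝ (Fin n) → EuclideanSpace ℝ (Fin n)}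

/-! ### Identification of V with the derivative of the flow. -/

section CharacteristicMatrix

theorem rpow_three_halves {x : ℝ} (hx : 0 ≤ x) : x ^ (3 / 2 : ℝ) = √x ^ 3 := by
  rw [Real.sqrt_eq_rpow, ← Real.rpow_natCast, ← Real.rpow_mul hx]
  norm_num

/-- The base of the power is the radicand divided by (c² - ε²|v₀|²)b², which turns the integrands of
V into those of the flow derivative. -/
theorem one_add_f₀_sq_rpow {α : EuclideanSpace ℝ (Fin n)} {b : ℝ} (hb : 0 < b)
    (hu : ‖ε • v₀ α‖ < c) :
    (1 + f₀ c ε v₀ α ^ 2 * b ^ (-2 : ℤ)) ^ (3 / 2 : ℝ) =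
      √(radicand b c (ε • v₀ α)) ^ 3 / (√(c ^ 2 - ε ^ 2 * ‖v₀ α‖ ^ 2) ^ 3 * b ^ 3) := by
  have hn : ‖ε • v₀ α‖ ^ 2 = ε ^ 2 * ‖v₀ α‖ ^ 2 := by rw [norm_smul, mul_pow, Real.norm_eq_abs, sq_abs]
  have hq : 0 < c ^ 2 - ε ^ 2 * ‖v₀ α‖ ^ 2 := by rw [← hn]; exact sub_pos.2 (sq_norm_lt hu)
  have hr := radicand_pos hb hu
  have h1 : 1 + f₀ c ε v₀ α ^ 2 * b ^ (-2 : ℤ) =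
      radicand b c (ε • v₀ α) / ((c ^ 2 - ε ^ 2 * ‖v₀ α‖ ^ 2) * b ^ 2) := by
    have : b ^ (-2 : ℤ) = (b ^ 2)⁻¹ := by rw [zpow_neg]; rfl
    rw [f₀, div_pow, Real.sq_sqrt hq.le, radicand, hn, this]
    field_simp
  rw [h1, rpow_three_halves (by positivity), Real.sqrt_div hr.le, Real.sqrt_mul hq.le,
    Real.sqrt_sq hb.le, div_pow, mul_pow]

theorem V_eq (ha : ∀ s, 0 ≤ s → 0 < a s) {t : ℝ} (ht : 0 ≤ t) {α : EuclideanSpace ℝ (Fin n)}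
    (hu : ‖ε • v₀ α‖ < c) :
    V a c ε v₀ t α = 1 + (ε * mainCoeff a c (ε • v₀ α) t) • jac v₀ α
      - (ε ^ 3 * perpCoeff a c (ε • v₀ α) t) •
        ((‖v₀ α‖ ^ 2 • (1 : Matrix (Fin n) (Fin n) ℝ)
          - Matrix.of fun i j => v₀ α i * v₀ α j) * jac v₀ α) := by
  have hn : ‖ε • v₀ α‖ ^ 2 = ε ^ 2 * ‖v₀ α‖ ^ 2 := by rw [norm_smul, mul_pow, Real.norm_eq_abs, sq_abs]
  have hq : 0 < c ^ 2 - ε ^ 2 * ‖v₀ α‖ ^ 2 := by rw [← hn]; exact sub_pos.2 (sq_norm_lt hu)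
  have hq' := Real.sqrt_pos.2 hq
  have hz2 : ∀ b : ℝ, b ^ (-2 : ℤ) = (b ^ 2)⁻¹ := fun b => by rw [zpow_neg]; rfl
  have hz4 : ∀ b : ℝ, b ^ (-4 : ℤ) = (b ^ 4)⁻¹ := fun b => by rw [zpow_neg]; rfl
  have hs : ∀ s ∈ uIcc 0 t, 0 < a s := fun s hs => ha s (by rw [uIcc_of_le ht] at hs; exact hs.1)
  have e1 : c ^ 3 * ε / (c ^ 2 - ε ^ 2 * ‖v₀ α‖ ^ 2) ^ (3 / 2 : ℝ) *
        (∫ s in (0 : ℝ)..t, a s ^ (-2 : ℤ) /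
          (1 + f₀ c ε v₀ α ^ 2 * a s ^ (-2 : ℤ)) ^ (3 / 2 : ℝ)) =
      ε * mainCoeff a c (ε • v₀ α) t := by
    rw [mainCoeff, ← intervalIntegral.integral_const_mul, ← intervalIntegral.integral_const_mul]
    refine intervalIntegral.integral_congr fun s h => ?_
    have hb := hs s h
    have hr := Real.sqrt_pos.2 (radicand_pos hb hu)
    rw [one_add_f₀_sq_rpow hb hu, rpow_three_halves hq.le, hz2]
    field_simp
  have e2 : c * ε ^ 3 / (c ^ 2 - ε ^ 2 * ‖v₀ α‖ ^ 2) ^ (3 / 2 : ℝ) *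
        (∫ s in (0 : ℝ)..t, (a s ^ (-2 : ℤ) - a s ^ (-4 : ℤ)) /
          (1 + f₀ c ε v₀ α ^ 2 * a s ^ (-2 : ℤ)) ^ (3 / 2 : ℝ)) =
      ε ^ 3 * perpCoeff a c (ε • v₀ α) t := by
    rw [perpCoeff, ← intervalIntegral.integral_const_mul, ← intervalIntegral.integral_const_mul]
    refine intervalIntegral.integral_congr fun s h => ?_
    have hb := hs s h
    have hr := Real.sqrt_pos.2 (radicand_pos hb hu)
    rw [one_add_f₀_sq_rpow hb hu, rpow_three_halves hq.le, hz2, hz4]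
    field_simp
  rw [V, e1, e2]

theorem jac_mulVec (w : EuclideanSpace ℝ (Fin n) → EuclideanSpace ℝ (Fin n))
    (x : EuclideanSpace ℝ (Fin n)) (ξ : Fin n → ℝ) :
    (jac w x).mulVec ξ = (fderiv ℝ w x (WithLp.toLp 2 ξ)).ofLp := by
  ext i
  exact sum_jac_mul w x (WithLp.toLp 2 ξ) i

theorem perpMatrix_mulVec (u : EuclideanSpace ℝ (Fin n)) (η : Fin n → ℝ) :
    (‖u‖ ^ 2 • (1 : Matrix (Fin n) (Fin n) ℝ) - Matrix.of fun i j => u i * u j).mulVec η =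
      (perp u (WithLp.toLp 2 η)).ofLp := by
  ext i
  rw [perp_apply, Matrix.sub_mulVec, Matrix.smul_mulVec, Matrix.one_mulVec]
  simp [Matrix.mulVec, dotProduct, PiLp.inner_apply, Finset.sum_mul]
  exact Finset.sum_congr rfl fun j _ => by ring

theorem V_mulVec (ha : ∀ s, 0 ≤ s → 0 < a s) {t : ℝ} (ht : 0 ≤ t) {α : EuclideanSpace ℝ (Fin n)}
    (hu : ‖ε • v₀ α‖ < c) (hd : DifferentiableAt ℝ v₀ α) (ξ : Fin n → ℝ) :
    (V a c ε v₀ t α).mulVec ξ =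
      (flowDeriv a c (fun x => ε • v₀ x) t α (WithLp.toLp 2 ξ)).ofLp := by
  rw [V_eq ha ht hu, Matrix.sub_mulVec, Matrix.add_mulVec, Matrix.smul_mulVec, Matrix.smul_mulVec,
    Matrix.one_mulVec, ← Matrix.mulVec_mulVec, jac_mulVec, perpMatrix_mulVec]
  have h1 : fderiv ℝ (fun x => ε • v₀ x) α = ε • fderiv ℝ v₀ α := fderiv_fun_const_smul hd ε
  simp only [flowDeriv, h1]
  have h2 : ∀ η, perp (ε • v₀ α) η = ε ^ 2 • perp (v₀ α) η := fun η => by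
    rw [perp_apply, perp_apply, norm_smul, mul_pow, Real.norm_eq_abs, sq_abs, real_inner_smul_left]
    module
  simp [h2, smul_smul]
  congr 2
  · ring_nf
  · ring_nf

theorem det_V_ne_zero_iff (ha : ∀ s, 0 ≤ s → 0 < a s) {t : ℝ} (ht : 0 ≤ t)
    {α : EuclideanSpace ℝ (Fin n)} (hu : ‖ε • v₀ α‖ < c) (hd : DifferentiableAt ℝ v₀ α) :
    (V a c ε v₀ t α).det ≠ 0 ↔
      ∀ k, flowDeriv a c (fun x => ε • v₀ x) t α k = 0 → k = 0 := by
  rw [Ne, ← Matrix.exists_mulVec_eq_zero_iff.not]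
  push Not
  constructor
  · intro h k hk
    by_contra hne
    refine h k.ofLp (fun h0 => hne (by ext i; exact congrFun h0 i)) ?_
    rw [V_mulVec ha ht hu hd]
    simp [hk]
  · intro h ξ hξ h0
    rw [V_mulVec ha ht hu hd] at h0
    have := h (WithLp.toLp 2 ξ) (by ext i; exact congrFun h0 i)
    exact hξ (by simpa using this)

end CharacteristicMatrix

/-! ### Extension to negative times and the determinant criterion. -/

section Extension

/-- The constant extension of a function on `[0, ∞)` to the negative half-line. -/
def extendLeft (a : ℝ → ℝ) (s : ℝ) : ℝ := a (max s 0)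

theorem extendLeft_of_nonneg {s : ℝ} (hs : 0 ≤ s) : extendLeft a s = a s := by
  rw [extendLeft, max_eq_left hs]

theorem dot_extendLeft {t : ℝ} (ht : 0 ≤ t) : dot (extendLeft a) t = dot a t :=
  derivWithin_congr (fun _ hs => extendLeft_of_nonneg hs) (extendLeft_of_nonneg ht)

/-- The flow is built from a continuous positive factor on all of ℝ, so that t = 0 is an interior
time for the inverse function theorem. Solutions see only t ≥ 0. -/
theorem isClassicalSolution_extendLeft_iff {w : EuclideanSpace ℝ (Fin n) → EuclideanSpace ℝ (Fin n)}
    {T : EReal} {v : ℝ → EuclideanSpace ℝ (Fin n) → EuclideanSpace ℝ (Fin n)} :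
    IsClassicalSolution (extendLeft a) c w T v ↔ IsClassicalSolution a c w T v := by
  constructor <;> intro h <;> refine ⟨h.contDiffOn, fun t h0 hT x i => ?_, h.init⟩ <;>
  · have := h.equation t h0 hT x i
    simpa only [extendLeft_of_nonneg h0, dot_extendLeft h0] using this

namespace IsScaleFactor

variable (ha : IsScaleFactor a)
include ha

theorem extend : IsScaleFactor (extendLeft a) where
  contDiffOn := ha.contDiffOn.congr fun _ hs => extendLeft_of_nonneg hs
  pos _ hs := by rw [extendLeft_of_nonneg hs]; exact ha.pos _ hs
  init := by rw [extendLeft_of_nonneg le_rfl, ha.init]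

theorem continuous_extendLeft : Continuous (extendLeft a) :=
  ha.contDiffOn.continuousOn.comp_continuous (by fun_prop) fun _ => mem_Ici.2 (le_max_right _ _)

theorem extendLeft_pos (s : ℝ) : 0 < extendLeft a s := ha.pos _ (le_max_right _ _)

end IsScaleFactor

theorem mainCoeff_extendLeft {t : ℝ} (ht : 0 ≤ t) (u : EuclideanSpace ℝ (Fin n)) :
    mainCoeff (extendLeft a) c u t = mainCoeff a c u t :=
  intervalIntegral.integral_congr fun s hs => by
    rw [uIcc_of_le ht] at hs
    simp only [extendLeft_of_nonneg hs.1]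

theorem perpCoeff_extendLeft {t : ℝ} (ht : 0 ≤ t) (u : EuclideanSpace ℝ (Fin n)) :
    perpCoeff (extendLeft a) c u t = perpCoeff a c u t :=
  intervalIntegral.integral_congr fun s hs => by
    rw [uIcc_of_le ht] at hs
    simp only [extendLeft_of_nonneg hs.1]

theorem V_extendLeft (ha : IsScaleFactor a) {t : ℝ} (ht : 0 ≤ t) {α : EuclideanSpace ℝ (Fin n)}
    (hu : ‖ε • v₀ α‖ < c) : V (extendLeft a) c ε v₀ t α = V a c ε v₀ t α := by
  rw [V_eq ha.extend.pos ht hu, V_eq ha.pos ht hu, mainCoeff_extendLeft ht, perpCoeff_extendLeft ht]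

theorem continuousOn_det_V (ha : IsScaleFactor a) {α : EuclideanSpace ℝ (Fin n)}
    (hu : ‖ε • v₀ α‖ < c) : ContinuousOn (fun t => (V a c ε v₀ t α).det) (Ici 0) := by
  have h1 : Continuous (mainCoeff (extendLeft a) c (ε • v₀ α)) :=
    intervalIntegral.continuous_primitive (fun _ _ => (continuous_mainCoeff_integrand
      ha.continuous_extendLeft ha.extendLeft_pos hu).intervalIntegrable _ _) 0
  have h2 : Continuous (perpCoeff (extendLeft a) c (ε • v₀ α)) :=
    intervalIntegral.continuous_primitive (fun _ _ => (continuous_perpCoeff_integrand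
      ha.continuous_extendLeft ha.extendLeft_pos hu).intervalIntegrable _ _) 0
  refine ContinuousOn.congr (f := fun t => (1 + (ε * mainCoeff (extendLeft a) c (ε • v₀ α) t) •
    jac v₀ α - (ε ^ 3 * perpCoeff (extendLeft a) c (ε • v₀ α) t) •
        ((‖v₀ α‖ ^ 2 • (1 : Matrix (Fin n) (Fin n) ℝ)
          - Matrix.of fun i j => v₀ α i * v₀ α j) * jac v₀ α)).det) ?_ fun t ht => ?_
  · refine Continuous.continuousOn (Continuous.matrix_det ?_)
    fun_prop
  · simp only
    rw [← V_extendLeft ha ht hu, V_eq ha.extend.pos ht hu]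

theorem V_zero (α : EuclideanSpace ℝ (Fin n)) : V a c ε v₀ 0 α = 1 := by
  simp [V]

/-- The determinant starts at 1 and is continuous in time. -/
theorem det_V_pos_of_ne_zero (ha : IsScaleFactor a) {α : EuclideanSpace ℝ (Fin n)}
    (hu : ‖ε • v₀ α‖ < c) {t : ℝ} (ht : 0 ≤ t) (h : ∀ s ∈ Icc 0 t, (V a c ε v₀ s α).det ≠ 0) :
    0 < (V a c ε v₀ t α).det := by
  by_contra hneg
  obtain ⟨s, hs, h0⟩ := intermediate_value_Icc' ht
    ((continuousOn_det_V ha hu).mono (Icc_subset_Ici_self : Icc 0 t ⊆ Ici 0))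
    (show (0 : ℝ) ∈ Icc _ _ from ⟨not_lt.1 hneg, by simp [V_zero]⟩)
  exact h s hs h0

/-- Classical solutions on `[0, T)` exist exactly when the characteristic Jacobian determinant
stays positive on `[0, T)`. -/
theorem exists_solution_iff (hc : 0 < c) (ha : IsScaleFactor a) (hv₀ : ContDiff ℝ 1 v₀)
    (hu : ∀ α, ‖ε • v₀ α‖ < c) {T : EReal} :
    (∃ v, IsClassicalSolution a c (fun x => ε • v₀ x) T v) ↔
      ∀ t ∈ slab T, ∀ α, 0 < (V a c ε v₀ t α).det := by
  have hw : ContDiff ℝ 1 fun x => ε • v₀ x := hv₀.const_smul ε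
  have hd := hv₀.differentiable one_ne_zero
  constructor
  · rintro ⟨v, hv⟩ t ht α
    rw [← isClassicalSolution_extendLeft_iff] at hv
    refine det_V_pos_of_ne_zero ha (hu α) ht.1 fun s hs => ?_
    rw [← V_extendLeft ha hs.1 (hu α), det_V_ne_zero_iff ha.extend.pos hs.1 (hu α) (hd α)]
    exact hv.flowDeriv_injective hc ha.extend ha.continuous_extendLeft ha.extendLeft_pos hu hw
      (mem_slab_of_mem_Icc ht hs) α
  · intro h
    obtain ⟨v, hv⟩ := exists_isClassicalSolution hc ha.extend ha.continuous_extendLeft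
      ha.extendLeft_pos hu hw (T := T) fun t ht α => by
        have := (h t ht α).ne'
        rwa [← V_extendLeft ha ht.1 (hu α), det_V_ne_zero_iff ha.extend.pos ht.1 (hu α) (hd α)]
          at this
    exact ⟨v, isClassicalSolution_extendLeft_iff.1 hv⟩

end Extension

/-! ### The life span in terms of the determinant. -/

section Lifespan

variable (hc : 0 < c) (ha : IsScaleFactor a) (hv₀ : ContDiff ℝ 1 v₀) (hu : ∀ α, ‖ε • v₀ α‖ < c)
include hc ha hv₀ hu

/-- The supremum is attained without gluing solutions: the determinant criterion is pointwise in t,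
and each t below the supremum lies below some admissible T. -/
theorem exists_solution_lifespan : ∃ v, IsClassicalSolution a c (fun x => ε • v₀ x)
    (lifespan a c (fun x => ε • v₀ x)) v := by
  rw [exists_solution_iff hc ha hv₀ hu]
  rintro t ⟨h0, ht⟩ α
  obtain ⟨T, hT, htT⟩ := lt_sSup_iff.1 ht
  exact (exists_solution_iff hc ha hv₀ hu).1 hT t ⟨h0, htT⟩ α

theorem le_lifespan {T : EReal} (h : ∀ t ∈ slab T, ∀ α, 0 < (V a c ε v₀ t α).det) :
    T ≤ lifespan a c (fun x => ε • v₀ x) :=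
  le_sSup ((exists_solution_iff hc ha hv₀ hu).2 h)

theorem det_V_pos_of_lt_lifespan {t : ℝ} (h0 : 0 ≤ t)
    (ht : (t : EReal) < lifespan a c (fun x => ε • v₀ x)) (α : EuclideanSpace ℝ (Fin n)) :
    0 < (V a c ε v₀ t α).det :=
  (exists_solution_iff hc ha hv₀ hu).1 (exists_solution_lifespan hc ha hv₀ hu) t ⟨h0, ht⟩ α

theorem lifespan_le {t : ℝ} (h0 : 0 ≤ t) {α : EuclideanSpace ℝ (Fin n)}
    (h : (V a c ε v₀ t α).det ≤ 0) : lifespan a c (fun x => ε • v₀ x) ≤ t :=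
  not_lt.1 fun hlt => h.not_gt (det_V_pos_of_lt_lifespan hc ha hv₀ hu h0 hlt α)

end Lifespan

end

section

variable {n : ℕ} {a : ℝ → ℝ} {c ε : ℝ}
  {v₀ : EuclideanSpace ℝ (Fin n) → EuclideanSpace ℝ (Fin n)}

/-! ### Comparison of the coefficients of V with ∫ a⁻². -/

section Coefficients

variable {E : Type*} [NormedAddCommGroup E]

theorem sqrt_radicand_cube_bounds {b : ℝ} (hb : 1 ≤ b) {u : E} (hc : 0 < c) (hu : ‖u‖ ≤ c / 2) :
    √(radicand b c u) ^ 3 ≤ (b * c) ^ 3 ∧ (b * c) ^ 3 ≤ 2 * √(radicand b c u) ^ 3 := by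
  have hu2 : ‖u‖ ^ 2 ≤ (c / 2) ^ 2 := pow_le_pow_left₀ (norm_nonneg _) hu 2
  have hb2 : 1 ≤ b ^ 2 := one_le_pow₀ hb
  have h1 : √(radicand b c u) ≤ b * c := by
    refine Real.sqrt_le_iff.2 ⟨by positivity, ?_⟩
    unfold radicand
    nlinarith [mul_nonneg (sub_nonneg.2 hb2) (sq_nonneg ‖u‖)]
  -- The radicand is at least (3/4)(bc)²; 4/5 is a rational below √3/2 whose cube still exceeds 1/2.
  have h2 : 4 / 5 * (b * c) ≤ √(radicand b c u) := by
    refine Real.le_sqrt_of_sq_le ?_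
    unfold radicand
    nlinarith [mul_nonneg (sq_nonneg b) (sub_nonneg.2 hu2), sq_nonneg ‖u‖, sq_nonneg (b * c)]
  refine ⟨pow_le_pow_left₀ (Real.sqrt_nonneg _) h1 3, ?_⟩
  have h3 := pow_le_pow_left₀ (by positivity) h2 3
  have h4 : 0 ≤ (b * c) ^ 3 := by positivity
  nlinarith

theorem mainCoeff_integrand_bounds {b : ℝ} (hb : 1 ≤ b) {u : E} (hc : 0 < c) (hu : ‖u‖ ≤ c / 2) :
    (b ^ 2)⁻¹ ≤ c ^ 3 * b / √(radicand b c u) ^ 3 ∧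
      c ^ 3 * b / √(radicand b c u) ^ 3 ≤ 2 * (b ^ 2)⁻¹ := by
  obtain ⟨h1, h2⟩ := sqrt_radicand_cube_bounds hb hc hu
  have h3 : 0 < √(radicand b c u) ^ 3 := by
    have : 0 < (b * c) ^ 3 := by positivity
    linarith
  have hb0 : 0 < b := by linarith
  constructor
  · rw [le_div_iff₀ h3, inv_mul_le_iff₀ (by positivity)]
    linarith
  · rw [div_le_iff₀ h3, ← div_eq_mul_inv, div_mul_eq_mul_div, le_div_iff₀ (by positivity)]
    linarith

theorem perpCoeff_integrand_bounds {b : ℝ} (hb : 1 ≤ b) {u : E} (hc : 0 < c) :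
    0 ≤ c * (b - b⁻¹) / √(radicand b c u) ^ 3 ∧
      c * (b - b⁻¹) / √(radicand b c u) ^ 3 ≤ (c ^ 2)⁻¹ * (c ^ 3 * b / √(radicand b c u) ^ 3) := by
  have h1 : b⁻¹ ≤ 1 := inv_le_one_of_one_le₀ hb
  have h2 : 0 ≤ b⁻¹ := by positivity
  constructor
  · have : 0 ≤ b - b⁻¹ := by linarith
    positivity
  · rw [← mul_div_assoc]
    have : (c ^ 2)⁻¹ * (c ^ 3 * b) = c * b := by field_simp
    rw [this]
    gcongr
    linarith

/-- The integral `∫₀ᵗ a⁻²`. -/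
noncomputable def invSqIntegral (a : ℝ → ℝ) (t : ℝ) : ℝ := ∫ s in (0 : ℝ)..t, (a s ^ 2)⁻¹

variable (ha : IsScaleFactor a)
include ha

theorem IsScaleFactor.intervalIntegrable_comp {f : ℝ → ℝ} (hf : ContinuousOn f (Ioi 0)) {s t : ℝ}
    (hs : 0 ≤ s) (ht : 0 ≤ t) :
    IntervalIntegrable (fun r => f (a r)) MeasureTheory.volume s t :=
  (hf.comp (ha.contDiffOn.continuousOn.mono fun _ hr => (le_min hs ht).trans hr.1)
    fun _ hr => ha.pos _ ((le_min hs ht).trans hr.1)).intervalIntegrable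

omit ha in
theorem continuousOn_inv_sq : ContinuousOn (fun b : ℝ => (b ^ 2)⁻¹) (Ioi 0) :=
  (continuousOn_id.pow 2).inv₀ fun _ hb => pow_ne_zero _ (ne_of_gt hb)

omit ha in
theorem continuousOn_sqrt_radicand_cube {u : E} :
    ContinuousOn (fun b : ℝ => √(radicand b c u) ^ 3) (Ioi 0) := by
  unfold radicand; fun_prop

omit ha in
theorem continuousOn_mainCoeff_integrand {u : E} (hu : ‖u‖ < c) :
    ContinuousOn (fun b : ℝ => c ^ 3 * b / √(radicand b c u) ^ 3) (Ioi 0) :=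
  (continuousOn_const.mul continuousOn_id).div continuousOn_sqrt_radicand_cube fun _ hb =>
    pow_ne_zero _ (Real.sqrt_pos.2 (radicand_pos hb hu)).ne'

omit ha in
theorem continuousOn_perpCoeff_integrand {u : E} (hu : ‖u‖ < c) :
    ContinuousOn (fun b : ℝ => c * (b - b⁻¹) / √(radicand b c u) ^ 3) (Ioi 0) :=
  (continuousOn_const.mul (continuousOn_id.sub
    (continuousOn_id.inv₀ fun _ hb => ne_of_gt hb))).div
    continuousOn_sqrt_radicand_cube fun _ hb =>
    pow_ne_zero _ (Real.sqrt_pos.2 (radicand_pos hb hu)).ne'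

variable (h1 : ∀ s, 0 ≤ s → 1 ≤ a s)

theorem invSqIntegral_nonneg {t : ℝ} (ht : 0 ≤ t) : 0 ≤ invSqIntegral a t :=
  intervalIntegral.integral_nonneg ht fun s hs => by have := ha.pos s hs.1; positivity

theorem invSqIntegral_mono {s t : ℝ} (hs : 0 ≤ s) (hst : s ≤ t) :
    invSqIntegral a s ≤ invSqIntegral a t := by
  have := intervalIntegral.integral_add_adjacent_intervals
    (ha.intervalIntegrable_comp continuousOn_inv_sq le_rfl hs)
    (ha.intervalIntegrable_comp continuousOn_inv_sq hs (hs.trans hst))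
  have h2 : 0 ≤ ∫ r in s..t, (a r ^ 2)⁻¹ := intervalIntegral.integral_nonneg hst fun r hr => by
    have := ha.pos r (hs.trans hr.1); positivity
  unfold invSqIntegral
  linarith

include h1

theorem invSqIntegral_le {t : ℝ} (ht : 0 ≤ t) : invSqIntegral a t ≤ t := by
  have := intervalIntegral.integral_mono_on ht
    (ha.intervalIntegrable_comp continuousOn_inv_sq le_rfl ht)
    (intervalIntegrable_const (c := (1 : ℝ)))
    (fun s hs => inv_le_one_of_one_le₀ (one_le_pow₀ (h1 s hs.1)))
  simpa [invSqIntegral] using this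

variable (hc : 0 < c) {u : E} (hu : ‖u‖ ≤ c / 2)
include hc hu

theorem mainCoeff_bounds {t : ℝ} (ht : 0 ≤ t) :
    invSqIntegral a t ≤ mainCoeff a c u t ∧ mainCoeff a c u t ≤ 2 * invSqIntegral a t := by
  have i1 := ha.intervalIntegrable_comp continuousOn_inv_sq le_rfl ht
  have i2 := ha.intervalIntegrable_comp
    (continuousOn_mainCoeff_integrand (hu.trans_lt (half_lt_self hc))) le_rfl ht
  refine ⟨intervalIntegral.integral_mono_on ht i1 i2 fun s hs =>
    (mainCoeff_integrand_bounds (h1 s hs.1) hc hu).1, ?_⟩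
  rw [invSqIntegral, ← intervalIntegral.integral_const_mul]
  exact intervalIntegral.integral_mono_on ht i2 (i1.const_mul 2) fun s hs =>
    (mainCoeff_integrand_bounds (h1 s hs.1) hc hu).2

theorem mainCoeff_sub_le {s t : ℝ} (hs : 0 ≤ s) (hst : s ≤ t) :
    0 ≤ mainCoeff a c u t - mainCoeff a c u s ∧
      mainCoeff a c u t - mainCoeff a c u s ≤ 2 * (t - s) := by
  have hi := continuousOn_mainCoeff_integrand (hu.trans_lt (half_lt_self hc))
  have := intervalIntegral.integral_add_adjacent_intervals
    (ha.intervalIntegrable_comp hi le_rfl hs) (ha.intervalIntegrable_comp hi hs (hs.trans hst))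
  have h2 : mainCoeff a c u t - mainCoeff a c u s =
      ∫ r in s..t, c ^ 3 * a r / √(radicand (a r) c u) ^ 3 := by
    unfold mainCoeff
    linarith
  rw [h2]
  have hb := fun r (hr : r ∈ Icc s t) => mainCoeff_integrand_bounds (h1 r (hs.trans hr.1)) hc hu
  refine ⟨intervalIntegral.integral_nonneg hst fun r hr => (inv_nonneg.2 (sq_nonneg _)).trans (hb r hr).1, ?_⟩
  have := intervalIntegral.integral_mono_on hst
    (ha.intervalIntegrable_comp hi hs (hs.trans hst))
    (intervalIntegrable_const (c := (2 : ℝ)))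
    (fun r hr => (hb r hr).2.trans (by
      have := inv_le_one_of_one_le₀ (one_le_pow₀ (h1 r (hs.trans hr.1)) (n := 2))
      linarith))
  simpa [mul_comm] using this

theorem perpCoeff_bounds {t : ℝ} (ht : 0 ≤ t) :
    0 ≤ perpCoeff a c u t ∧ perpCoeff a c u t ≤ (c ^ 2)⁻¹ * mainCoeff a c u t := by
  have hu' := hu.trans_lt (half_lt_self hc)
  refine ⟨intervalIntegral.integral_nonneg ht fun s hs =>
    (perpCoeff_integrand_bounds (h1 s hs.1) hc).1, ?_⟩
  rw [mainCoeff, ← intervalIntegral.integral_const_mul]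
  exact intervalIntegral.integral_mono_on ht
    (ha.intervalIntegrable_comp (continuousOn_perpCoeff_integrand hu') le_rfl ht)
    ((ha.intervalIntegrable_comp (continuousOn_mainCoeff_integrand hu') le_rfl ht).const_mul _)
    fun s hs => (perpCoeff_integrand_bounds (h1 s hs.1) hc).2

end Coefficients

/-! ### When the determinant is positive and when it is negative. -/

section DeterminantSign

theorem norm_perp_le {E : Type*} [NormedAddCommGroup E] [InnerProductSpace ℝ E] (u η : E) :
    ‖perp u η‖ ≤ 2 * ‖u‖ ^ 2 * ‖η‖ := by
  rw [perp_apply]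
  refine (norm_sub_le _ _).trans ?_
  rw [norm_smul, norm_smul, Real.norm_of_nonneg (sq_nonneg _)]
  nlinarith [mul_le_mul_of_nonneg_right (norm_inner_le_norm (𝕜 := ℝ) u η) (norm_nonneg u)]

/-- The determinant is positive as long as `ε ∫₀ᵗ a⁻²` is small. -/
theorem det_V_pos_of_small (ha : IsScaleFactor a) (h1 : ∀ s, 0 ≤ s → 1 ≤ a s) (hc : 0 < c)
    (hv₀ : Differentiable ℝ v₀) {α : EuclideanSpace ℝ (Fin n)} (hu : ‖ε • v₀ α‖ ≤ c / 2)
    (hε : 0 ≤ ε) {N : ℝ} (hN : ‖fderiv ℝ v₀ α‖ ≤ N) {t : ℝ} (ht : 0 ≤ t)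
    (hsmall : 3 * ε * N * invSqIntegral a t < 1) : 0 < (V a c ε v₀ t α).det := by
  have hu' := hu.trans_lt (half_lt_self hc)
  have hN0 : 0 ≤ N := (norm_nonneg _).trans hN
  refine det_V_pos_of_ne_zero ha hu' ht fun s hs => ?_
  rw [det_V_ne_zero_iff ha.pos hs.1 hu' (hv₀ α)]
  intro k hk
  by_contra hne
  have hk0 : 0 < ‖k‖ := norm_pos_iff.2 hne
  obtain ⟨m1, m2⟩ := mainCoeff_bounds ha h1 hc hu hs.1
  obtain ⟨p1, p2⟩ := perpCoeff_bounds ha h1 hc hu hs.1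
  have hI0 := invSqIntegral_nonneg ha hs.1
  have hI := invSqIntegral_mono ha hs.1 hs.2
  have hfd : fderiv ℝ (fun x => ε • v₀ x) α = ε • fderiv ℝ v₀ α := fderiv_fun_const_smul (hv₀ α) ε
  simp only [flowDeriv, hfd] at hk
  set m := mainCoeff a c (ε • v₀ α) s
  set p := perpCoeff a c (ε • v₀ α) s
  set η := (ε • fderiv ℝ v₀ α) k with hη
  have hηn : ‖η‖ ≤ ε * N * ‖k‖ := by
    rw [hη, smul_apply, norm_smul, Real.norm_of_nonneg hε, mul_assoc]
    gcongr
    exact (ContinuousLinearMap.le_opNorm _ _).trans (by gcongr)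
  have hk' : k = p • perp (ε • v₀ α) η - m • η := by
    have : k + m • η - p • perp (ε • v₀ α) η = 0 := hk
    rw [← sub_eq_zero, ← this]; abel
  have h2 : ‖k‖ ≤ p * (2 * (c / 2) ^ 2 * ‖η‖) + m * ‖η‖ := by
    have hm0 : 0 ≤ m := hI0.trans m1
    calc ‖k‖ = ‖p • perp (ε • v₀ α) η - m • η‖ := by rw [← hk']
      _ ≤ p * ‖perp (ε • v₀ α) η‖ + m * ‖η‖ := by
        refine (norm_sub_le _ _).trans ?_
        rw [norm_smul, norm_smul, Real.norm_of_nonneg p1, Real.norm_of_nonneg hm0]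
      _ ≤ _ := by
        gcongr
        refine (norm_perp_le _ _).trans ?_
        gcongr
  -- Since p ≤ m/c² and |εv₀| ≤ c/2, the second term costs at most half of the main one; the total
  -- 3m/2 ≤ 3I explains the constant 3 in the smallness condition.
  have h3 : p * (2 * (c / 2) ^ 2 * ‖η‖) ≤ m / 2 * ‖η‖ := by
    have : p * (2 * (c / 2) ^ 2) ≤ m / 2 := by
      calc p * (2 * (c / 2) ^ 2) ≤ (c ^ 2)⁻¹ * m * (2 * (c / 2) ^ 2) := by gcongr
        _ = m / 2 := by field_simp
    calc _ = p * (2 * (c / 2) ^ 2) * ‖η‖ := by ring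
      _ ≤ _ := by gcongr
  have hI0' := hI0.trans hI
  have hm2 : m ≤ 2 * invSqIntegral a t := by linarith
  have h4 : ‖k‖ ≤ 3 * ε * N * invSqIntegral a t * ‖k‖ := by
    calc ‖k‖ ≤ 3 / 2 * m * ‖η‖ := by linarith
      _ ≤ 3 / 2 * (2 * invSqIntegral a t) * (ε * N * ‖k‖) := by gcongr
      _ = _ := by ring
  nlinarith

/-- The matrix is |u|² times the orthogonal projection onto the complement of u. This relation gives
I - sM an explicit inverse of the form I + yM. -/
theorem perpMatrix_mul_self (u : EuclideanSpace ℝ (Fin n)) :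
    (‖u‖ ^ 2 • (1 : Matrix (Fin n) (Fin n) ℝ) - Matrix.of fun i j => u i * u j) *
      (‖u‖ ^ 2 • (1 : Matrix (Fin n) (Fin n) ℝ) - Matrix.of fun i j => u i * u j) =
    ‖u‖ ^ 2 • (‖u‖ ^ 2 • (1 : Matrix (Fin n) (Fin n) ℝ) - Matrix.of fun i j => u i * u j) := by
  have hP : (Matrix.of fun i j => u i * u j) * (Matrix.of fun i j => u i * u j) =
      ‖u‖ ^ 2 • Matrix.of fun i j => u i * u j := by
    ext i j
    simp only [Matrix.mul_apply, Matrix.of_apply, Matrix.smul_apply, smul_eq_mul,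
      EuclideanSpace.real_norm_sq_eq, Finset.sum_mul]
    exact Finset.sum_congr rfl fun k _ => by ring
  set P : Matrix (Fin n) (Fin n) ℝ := Matrix.of fun i j => u i * u j
  rw [sub_mul, mul_sub, mul_sub, hP]
  simp only [Matrix.smul_mul, Matrix.mul_smul, Matrix.one_mul, Matrix.mul_one]
  module

variable {M : Matrix (Fin n) (Fin n) ℝ} {q : ℝ} (hM : M * M = q • M)
include hM

theorem one_sub_smul_mul {s : ℝ} (hs : s * q < 1) :
    (1 - s • M) * (1 + (s / (1 - s * q)) • M) = 1 := by
  have h : (1 - s * q) ≠ 0 := by linarith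
  rw [sub_mul, mul_add, mul_add]
  simp only [Matrix.smul_mul, Matrix.mul_smul, hM, Matrix.mul_one, Matrix.one_mul, smul_smul]
  have : s / (1 - s * q) - s - s / (1 - s * q) * (s * q) = 0 := by field_simp; ring
  have h2 : (1 : Matrix (Fin n) (Fin n) ℝ) + (s / (1 - s * q)) • M
      - (s • M + (s / (1 - s * q) * (s * q)) • M) =
      1 + (s / (1 - s * q) - s - s / (1 - s * q) * (s * q)) • M := by module
  rw [h2, this, zero_smul, add_zero]

theorem det_one_sub_smul_pos {s : ℝ} (h0 : 0 ≤ s) (hq : 0 ≤ q) (hs : s * q < 1) :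
    0 < (1 - s • M).det := by
  by_contra hneg
  have hc : Continuous fun r : ℝ => (1 - r • M).det := by
    refine Continuous.matrix_det ?_
    fun_prop
  obtain ⟨r, hr, hr0⟩ := intermediate_value_Icc' h0 hc.continuousOn
    (show (0 : ℝ) ∈ Icc _ _ from ⟨not_lt.1 hneg, by simp⟩)
  have h2 := congrArg Matrix.det
    (one_sub_smul_mul hM (lt_of_le_of_lt (mul_le_mul_of_nonneg_right hr.2 hq) hs))
  simp only at hr0
  rw [Matrix.det_mul, hr0, zero_mul, Matrix.det_one] at h2
  exact zero_ne_one h2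

omit hM in
/-- If `det ∂v₀/∂α < 0`, the determinant is negative once `ε ∫₀ᵗ a⁻²` is large. -/
theorem exists_det_V_neg (ha : IsScaleFactor a) (h1 : ∀ s, 0 ≤ s → 1 ≤ a s) (hc : 0 < c)
    {ε₀ : ℝ} {α : EuclideanSpace ℝ (Fin n)} (hu : ε₀ * ‖v₀ α‖ ≤ c / 2)
    (hJ : (jac v₀ α).det < 0) :
    ∃ C > 0, ∀ ε ∈ Ioc 0 ε₀, ∀ t, 0 ≤ t → C ≤ ε * invSqIntegral a t →
      (V a c ε v₀ t α).det < 0 := by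
  set M : Matrix (Fin n) (Fin n) ℝ :=
    ‖v₀ α‖ ^ 2 • (1 : Matrix (Fin n) (Fin n) ℝ) - Matrix.of fun i j => v₀ α i * v₀ α j with hMdef
  have hM : M * M = ‖v₀ α‖ ^ 2 • M := perpMatrix_mul_self _
  have hcont : Continuous fun z : ℝ × ℝ => (z.1 • (1 + z.2 • M) + jac v₀ α).det := by
    refine Continuous.matrix_det ?_
    fun_prop
  -- At x = 0 the determinant is det Dv₀(α) < 0 for every y. The interval of y is compact and
  -- independent of ε, so one δ serves all ε.
  have hev : ∀ y ∈ Icc 0 (2 * ε₀ ^ 2 / c ^ 2), ∀ᶠ z in 𝓝 ((0 : ℝ), y),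
      (z.1 • (1 + z.2 • M) + jac v₀ α).det < 0 := fun y _ =>
    hcont.continuousAt.eventually (gt_mem_nhds (by simpa using hJ))
  have hev' : ∀ᶠ x in 𝓝 (0 : ℝ), ∀ y ∈ Icc 0 (2 * ε₀ ^ 2 / c ^ 2),
      (x • (1 + y • M) + jac v₀ α).det < 0 :=
    isCompact_Icc.eventually_forall_of_forall_eventually fun y hy => hev y hy
  obtain ⟨δ, hδ, hball⟩ := Metric.eventually_nhds_iff.1 hev'
  refine ⟨2 / δ, by positivity, fun ε hε t ht hC => ?_⟩
  have huε : ‖ε • v₀ α‖ ≤ c / 2 := by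
    rw [norm_smul, Real.norm_of_nonneg hε.1.le]
    exact (mul_le_mul_of_nonneg_right hε.2 (norm_nonneg _)).trans hu
  rw [V_eq ha.pos ht (huε.trans_lt (half_lt_self hc)), ← hMdef]
  clear_value M
  obtain ⟨m1, -⟩ := mainCoeff_bounds ha h1 hc huε ht
  obtain ⟨p1, p2⟩ := perpCoeff_bounds ha h1 hc huε ht
  set m := mainCoeff a c (ε • v₀ α) t
  set p := perpCoeff a c (ε • v₀ α) t
  have hεm : 2 / δ ≤ ε * m := hC.trans (mul_le_mul_of_nonneg_left m1 hε.1.le)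
  have hεm0 : 0 < ε * m := lt_of_lt_of_le (by positivity) hεm
  have hm0 : 0 < m := pos_of_mul_pos_right hεm0 hε.1.le
  set s := ε ^ 2 * p / m with hs
  have hs0 : 0 ≤ s := by positivity
  have hsle : s ≤ ε ^ 2 / c ^ 2 := by
    rw [hs, div_le_iff₀ hm0]
    calc ε ^ 2 * p ≤ ε ^ 2 * ((c ^ 2)⁻¹ * m) := by gcongr
      _ = _ := by ring
  have hsq : s * ‖v₀ α‖ ^ 2 ≤ 1 / 4 := by
    have h2 : ε ^ 2 * ‖v₀ α‖ ^ 2 ≤ (c / 2) ^ 2 := by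
      have := pow_le_pow_left₀ (norm_nonneg _) huε 2
      rwa [norm_smul, mul_pow, Real.norm_eq_abs, sq_abs] at this
    calc s * ‖v₀ α‖ ^ 2 ≤ ε ^ 2 / c ^ 2 * ‖v₀ α‖ ^ 2 := by gcongr
      _ = ε ^ 2 * ‖v₀ α‖ ^ 2 / c ^ 2 := by ring
      _ ≤ (c / 2) ^ 2 / c ^ 2 := by gcongr
      _ = 1 / 4 := by field_simp; norm_num
  set y := s / (1 - s * ‖v₀ α‖ ^ 2) with hy
  have hy0 : 0 ≤ y := div_nonneg hs0 (by linarith)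
  have hyle : y ≤ 2 * ε₀ ^ 2 / c ^ 2 := by
    rw [hy, div_le_iff₀ (by linarith)]
    have h3 : ε ^ 2 / c ^ 2 ≤ ε₀ ^ 2 / c ^ 2 := by
      have := pow_le_pow_left₀ hε.1.le hε.2 2
      gcongr
    have h4 : 0 ≤ ε₀ ^ 2 / c ^ 2 := by positivity
    rw [mul_div_assoc]
    nlinarith
  -- With s = ε²p/m both nontrivial terms share the factor I - sM, and I equals (I - sM)(I + yM).
  -- That factor has positive determinant, and the bracket tends to Dv₀ as εm grows.
  have hfac : 1 + (ε * m) • jac v₀ α - (ε ^ 3 * p) • (M * jac v₀ α) =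
      (1 - s • M) * ((ε * m) • ((ε * m)⁻¹ • (1 + y • M) + jac v₀ α)) := by
    rw [smul_add, smul_smul, mul_inv_cancel₀ hεm0.ne', one_smul, mul_add,
      one_sub_smul_mul hM (by linarith), sub_mul, Matrix.one_mul, Matrix.smul_mul, Matrix.mul_smul,
      smul_smul, add_sub_assoc]
    have : s * (ε * m) = ε ^ 3 * p := by rw [hs]; field_simp
    rw [this]
  rw [hfac, Matrix.det_mul, Matrix.det_smul]
  have hx : (ε * m)⁻¹ < δ := by
    have h5 : (ε * m)⁻¹ ≤ (2 / δ)⁻¹ := inv_anti₀ (by positivity) hεm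
    rw [inv_div] at h5
    linarith
  have hneg := hball (y := (ε * m)⁻¹) (by
    rw [Real.dist_eq, sub_zero, abs_of_pos (inv_pos.2 hεm0)]; exact hx) y ⟨hy0, hyle⟩
  exact mul_neg_of_pos_of_neg
    (det_one_sub_smul_pos hM hs0 (sq_nonneg _) (by linarith))
    (mul_neg_of_pos_of_neg (pow_pos hεm0 _) hneg)

end DeterminantSign

end

/-! ### Growth of ∫ a⁻² under the hypotheses on the scale factor. -/

section ScaleFactorGrowth

variable {a : ℝ → ℝ}

theorem monotoneOn_Ici_of_hasDerivWithinAt {f f' : ℝ → ℝ}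
    (hf : ∀ t, 0 ≤ t → HasDerivWithinAt f (f' t) (Ici 0) t) (h0 : ∀ t, 0 ≤ t → 0 ≤ f' t) :
    MonotoneOn f (Ici 0) := by
  have hd : ∀ t ∈ interior (Ici (0 : ℝ)), HasDerivAt f (f' t) t := fun t ht => by
    rw [interior_Ici] at ht
    exact (hf t (le_of_lt ht)).hasDerivAt (Ici_mem_nhds ht)
  refine monotoneOn_of_deriv_nonneg (convex_Ici 0) (fun t ht => (hf t ht).continuousWithinAt)
    (fun t ht => (hd t ht).differentiableAt.differentiableWithinAt) fun t ht => ?_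
  rw [(hd t ht).deriv]
  exact h0 t (interior_subset ht)

theorem IsScaleFactor.monotoneOn (ha : IsScaleFactor a) (h : ∀ t, 0 ≤ t → 0 < dot a t) :
    MonotoneOn a (Ici 0) :=
  monotoneOn_Ici_of_hasDerivWithinAt (fun _ ht => ha.hasDerivWithinAt ht) fun t ht => (h t ht).le

theorem IsScaleFactor.one_le (ha : IsScaleFactor a) (h : ∀ t, 0 ≤ t → 0 < dot a t) (t : ℝ)
    (ht : 0 ≤ t) : 1 ≤ a t := by
  rw [← ha.init]
  exact ha.monotoneOn h (le_refl (0 : ℝ)) ht ht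

/-- A convex function lies above its tangent: a(t) ≥ 1 + ȧ(0)t. The exponent 1 is kept as a real
power to match the bound for exponents p > 1/2. -/
theorem H1.exists_linear_lower_bound (ha : IsScaleFactor a) (h : H1 a) :
    ∃ k > 0, ∀ t, 0 ≤ t → k * (1 + t) ^ (1 : ℝ) ≤ a t := by
  have hdot : ∀ t, 0 ≤ t → HasDerivWithinAt (dot a) (ddot a t) (Ici 0) t := fun t ht =>
    ((ha.contDiffOn.derivWithin (m := 1) (uniqueDiffOn_Ici 0) (by norm_num)).differentiableOn
      one_ne_zero t ht).hasDerivWithinAt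
  have hmono : MonotoneOn (dot a) (Ici 0) :=
    monotoneOn_Ici_of_hasDerivWithinAt hdot fun t ht => (h t ht).2
  have hlin : MonotoneOn (fun t => a t - dot a 0 * t) (Ici 0) :=
    monotoneOn_Ici_of_hasDerivWithinAt (f' := fun t => dot a t - dot a 0 * 1)
      (fun t ht => (ha.hasDerivWithinAt ht).sub ((hasDerivWithinAt_id t _).const_mul _))
      fun t ht => by
        have := hmono (le_refl (0 : ℝ)) ht ht
        linarith
  have hm := (h 0 le_rfl).1
  refine ⟨min (dot a 0) 1, lt_min hm one_pos, fun t ht => ?_⟩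
  have h1 := hlin (le_refl (0 : ℝ)) ht ht
  simp only [ha.init, mul_zero, sub_zero] at h1
  rw [Real.rpow_one]
  have h2 : min (dot a 0) 1 * t ≤ dot a 0 * t := by gcongr; exact min_le_left _ _
  have h3 := min_le_right (dot a 0) 1
  linarith

theorem integral_one_add_rpow {r t : ℝ} (hr : r ≠ -1) (ht : 0 ≤ t) :
    ∫ s in (0 : ℝ)..t, (1 + s) ^ r = ((1 + t) ^ (r + 1) - 1) / (r + 1) := by
  rw [intervalIntegral.integral_comp_add_left (fun x => x ^ r) 1, integral_rpow]
  · simp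
  · refine Or.inr ⟨hr, fun h => ?_⟩
    rw [uIcc_of_le (by linarith)] at h
    linarith [h.1]

theorem integral_one_add_rpow_neg_one {t : ℝ} (ht : 0 ≤ t) :
    ∫ s in (0 : ℝ)..t, (1 + s) ^ (-1 : ℝ) = Real.log (1 + t) := by
  simp_rw [Real.rpow_neg_one]
  rw [intervalIntegral.integral_comp_add_left (fun x => x⁻¹) 1, integral_inv_of_pos (by norm_num)
    (by linarith)]
  simp

theorem intervalIntegrable_one_add_rpow (r : ℝ) {t : ℝ} (ht : 0 ≤ t) :
    IntervalIntegrable (fun s : ℝ => (1 + s) ^ r) MeasureTheory.volume 0 t := by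
  refine ContinuousOn.intervalIntegrable fun s hs => ?_
  rw [uIcc_of_le ht] at hs
  have : 1 + s ≠ 0 := by linarith [hs.1]
  exact ((Real.continuousAt_rpow_const _ _ (Or.inl this)).comp
    (by fun_prop : ContinuousAt (fun s : ℝ => 1 + s) s)).continuousWithinAt

theorem inv_sq_mul_rpow {k p s : ℝ} (hs : 0 ≤ s) :
    ((k * (1 + s) ^ p) ^ 2)⁻¹ = (k ^ 2)⁻¹ * (1 + s) ^ (-(2 * p)) := by
  rw [mul_pow, mul_inv, Real.rpow_neg (by linarith), mul_comm 2 p, Real.rpow_mul (by linarith)]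
  norm_cast

theorem invSqIntegral_le_integral_rpow (ha : IsScaleFactor a) {k p : ℝ} (hk : 0 < k)
    (h : ∀ s, 0 ≤ s → k * (1 + s) ^ p ≤ a s) {t : ℝ} (ht : 0 ≤ t) :
    invSqIntegral a t ≤ (k ^ 2)⁻¹ * ∫ s in (0 : ℝ)..t, (1 + s) ^ (-(2 * p)) := by
  rw [← intervalIntegral.integral_const_mul]
  refine intervalIntegral.integral_mono_on ht
    (ha.intervalIntegrable_comp continuousOn_inv_sq le_rfl ht)
    ((intervalIntegrable_one_add_rpow _ ht).const_mul _) fun s hs => ?_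
  rw [← inv_sq_mul_rpow hs.1]
  have h1 : 0 < k * (1 + s) ^ p := mul_pos hk (Real.rpow_pos_of_pos (by linarith [hs.1]) _)
  exact inv_anti₀ (by positivity) (pow_le_pow_left₀ h1.le (h s hs.1) 2)

theorem integral_rpow_le_invSqIntegral (ha : IsScaleFactor a) {K p : ℝ}
    (h : ∀ s, 0 ≤ s → a s ≤ K * (1 + s) ^ p) {t : ℝ} (ht : 0 ≤ t) :
    (K ^ 2)⁻¹ * ∫ s in (0 : ℝ)..t, (1 + s) ^ (-(2 * p)) ≤ invSqIntegral a t := by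
  rw [← intervalIntegral.integral_const_mul]
  refine intervalIntegral.integral_mono_on ht
    ((intervalIntegrable_one_add_rpow _ ht).const_mul _)
    (ha.intervalIntegrable_comp continuousOn_inv_sq le_rfl ht) fun s hs => ?_
  rw [← inv_sq_mul_rpow hs.1]
  have h1 := ha.pos s hs.1
  exact inv_anti₀ (by positivity) (pow_le_pow_left₀ h1.le (h s hs.1) 2)

theorem exists_invSqIntegral_le_of_rpow (ha : IsScaleFactor a) {k p : ℝ} (hk : 0 < k)
    (hp : 1 / 2 < p) (h : ∀ s, 0 ≤ s → k * (1 + s) ^ p ≤ a s) :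
    ∃ B, ∀ t, 0 ≤ t → invSqIntegral a t ≤ B := by
  refine ⟨(k ^ 2)⁻¹ * (1 / (2 * p - 1)), fun t ht => ?_⟩
  refine (invSqIntegral_le_integral_rpow ha hk h ht).trans ?_
  rw [integral_one_add_rpow (by linarith) ht]
  have h1 : 0 ≤ (1 + t) ^ (-(2 * p) + 1) := Real.rpow_nonneg (by linarith) _
  refine mul_le_mul_of_nonneg_left ?_ (by positivity)
  rw [← neg_div_neg_eq, show -(-(2 * p) + 1) = 2 * p - 1 by ring]
  exact div_le_div_of_nonneg_right (by linarith) (by linarith)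

theorem exists_invSqIntegral_le (ha : IsScaleFactor a) (h : H1 a ∨ H2 a) :
    ∃ B, ∀ t, 0 ≤ t → invSqIntegral a t ≤ B := by
  rcases h with h | ⟨-, δ, hδ, -, h⟩
  · obtain ⟨k, hk, h'⟩ := h.exists_linear_lower_bound ha
    exact exists_invSqIntegral_le_of_rpow ha hk (by norm_num) h'
  · exact exists_invSqIntegral_le_of_rpow (k := 1) (p := (1 + δ) / 2) ha one_pos (by linarith)
      fun s hs => by rw [one_mul]; exact h s hs

end ScaleFactorGrowth

/-! ### Trading Q/ε + 1 for powers of 1/ε. -/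

section Powers

/-- With a common outer exponent, the two forms of the life span bound differ only in (1/ε)^P
against Q/ε + 1. -/
theorem rpow_div_sub_one {ε l P : ℝ} (hε : 0 < ε) :
    ε ^ (P / (2 * l - 1)) = ((1 / ε) ^ P) ^ (1 / (1 - 2 * l)) := by
  rw [← Real.rpow_mul (by positivity), one_div ε, Real.inv_rpow hε.le, ← Real.rpow_neg hε.le]
  congr 1
  rw [← neg_sub 1 (2 * l), div_neg]
  ring

/-- Bernoulli's inequality for an exponent P ≤ 1, with P ≤ Q. -/
theorem exists_rpow_le_div_add_one {Q : ℝ} (hQ : 0 < Q) :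
    ∃ P : ℝ, 0 < P ∧ ∀ ε ∈ Ioc (0 : ℝ) (1 / 2), (1 / ε) ^ P ≤ Q / ε + 1 := by
  refine ⟨min 1 Q, lt_min one_pos hQ, fun ε hε => ?_⟩
  have hy : 1 ≤ 1 / ε := by
    rw [le_div_iff₀ hε.1]; linarith [hε.2]
  have h1 := rpow_one_add_le_one_add_mul_self (s := 1 / ε - 1) (p := min 1 Q) (by linarith)
    (lt_min one_pos hQ).le (min_le_left _ _)
  rw [add_sub_cancel] at h1
  have h2 : min 1 Q * (1 / ε - 1) ≤ Q * (1 / ε) :=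
    mul_le_mul (min_le_right _ _) (by linarith) (by linarith) hQ.le
  have h3 : Q / ε = Q * (1 / ε) := by ring
  linarith

/-- With y = 1/ε ≥ 2 and 2^m > Q + 1, one has y^(m+1) ≥ (Q + 1)y ≥ Qy + 1. This needs 1/ε bounded
away from 1, hence the requirement ε₀ ≤ 1/2. -/
theorem exists_div_add_one_le_rpow (Q : ℝ) :
    ∃ P : ℝ, 0 < P ∧ ∀ ε ∈ Ioc (0 : ℝ) (1 / 2), Q / ε + 1 ≤ (1 / ε) ^ P := by
  obtain ⟨m, hm⟩ := pow_unbounded_of_one_lt (Q + 1) (one_lt_two (α := ℝ))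
  refine ⟨((m + 1 : ℕ) : ℝ), by positivity, fun ε hε => ?_⟩
  have hy : 2 ≤ 1 / ε := by
    rw [le_div_iff₀ hε.1]; linarith [hε.2]
  have h1 : (2 : ℝ) ^ m ≤ (1 / ε) ^ m := pow_le_pow_left₀ (by norm_num) hy m
  rw [Real.rpow_natCast, pow_succ]
  have h3 : Q / ε = Q * (1 / ε) := by ring
  nlinarith

end Powers

/-! ### Life span bounds for small data. -/

section LifespanBounds

variable {n : ℕ} {a : ℝ → ℝ} {c ε₀ N : ℝ}
  {v₀ : EuclideanSpace ℝ (Fin n) → EuclideanSpace ℝ (Fin n)}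

/-- The smallness conditions on the data under which the life span is estimated. -/
structure SmallData (a : ℝ → ℝ) (c ε₀ N : ℝ)
    (v₀ : EuclideanSpace ℝ (Fin n) → EuclideanSpace ℝ (Fin n)) : Prop where
  speed_pos : 0 < c
  scale : IsScaleFactor a
  smooth : ContDiff ℝ 1 v₀
  bound_pos : 0 < N
  fderiv_le : ∀ α, ‖fderiv ℝ v₀ α‖ ≤ N
  le_half : ε₀ ≤ 1 / 2
  mul_norm_le : ∀ α, ε₀ * ‖v₀ α‖ ≤ c / 2

namespace SmallData

variable (h : SmallData a c ε₀ N v₀) {ε : ℝ}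
include h

theorem norm_smul_le (hε : ε ∈ Icc 0 ε₀) (α : EuclideanSpace ℝ (Fin n)) :
    ‖ε • v₀ α‖ ≤ c / 2 := by
  rw [norm_smul, Real.norm_of_nonneg hε.1]
  exact (mul_le_mul_of_nonneg_right hε.2 (norm_nonneg _)).trans (h.mul_norm_le α)

theorem norm_smul_lt (hε : ε ∈ Icc 0 ε₀) (α : EuclideanSpace ℝ (Fin n)) : ‖ε • v₀ α‖ < c :=
  (h.norm_smul_le hε α).trans_lt (half_lt_self h.speed_pos)

theorem le_lifespan_of_small (h1 : ∀ s, 0 ≤ s → 1 ≤ a s) (hε : ε ∈ Icc 0 ε₀) {T : EReal}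
    (hT : ∀ t : ℝ, 0 ≤ t → (t : EReal) < T → 3 * ε * N * invSqIntegral a t < 1) :
    T ≤ lifespan a c (fun x => ε • v₀ x) :=
  le_lifespan h.speed_pos h.scale h.smooth (h.norm_smul_lt hε) fun t ht α =>
    det_V_pos_of_small h.scale h1 h.speed_pos (h.smooth.differentiable one_ne_zero)
      (h.norm_smul_le hε α) hε.1 (h.fderiv_le α) ht.1 (hT t ht.1 ht.2)

theorem lifespan_pos (h1 : ∀ s, 0 ≤ s → 1 ≤ a s) (hε : ε ∈ Ioc 0 ε₀) :
    0 < lifespan a c (fun x => ε • v₀ x) := by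
  have hN := h.bound_pos
  have hε0 := hε.1
  refine lt_of_lt_of_le (b := ((1 / (3 * ε * N) : ℝ) : EReal)) (by
    have : (0 : ℝ) < 1 / (3 * ε * N) := by positivity
    exact_mod_cast this) (h.le_lifespan_of_small h1 (Ioc_subset_Icc_self hε) fun t ht hlt => ?_)
  have hlt : t < 1 / (3 * ε * N) := by exact_mod_cast hlt
  rw [lt_div_iff₀ (by positivity)] at hlt
  have := mul_le_mul_of_nonneg_left (invSqIntegral_le h.scale h1 ht)
    (by positivity : 0 ≤ 3 * ε * N)
  linarith

variable (h1 : ∀ s, 0 ≤ s → 1 ≤ a s) {l k K : ℝ}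
include h1

theorem exists_rpow_le_lifespan (hl : l < 1 / 2) (hk : 0 < k)
    (hka : ∀ s, 0 ≤ s → k * (1 + s) ^ l ≤ a s) :
    ∃ Q > 0, ∀ ε ∈ Ioc 0 ε₀, (((Q / ε + 1) ^ (1 / (1 - 2 * l)) - 1 : ℝ) : EReal)
      ≤ lifespan a c (fun x => ε • v₀ x) := by
  have hN := h.bound_pos
  have hr : 0 < 1 - 2 * l := by linarith
  -- Chosen so that the upper bound for 3εN·I(t) reaches 1 exactly at the claimed time.
  refine ⟨(1 - 2 * l) * k ^ 2 / (3 * N), by positivity, fun ε hε =>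
    h.le_lifespan_of_small h1 (Ioc_subset_Icc_self hε) fun t ht hlt => ?_⟩
  have hε0 := hε.1
  have hlt : t < ((1 - 2 * l) * k ^ 2 / (3 * N) / ε + 1) ^ (1 / (1 - 2 * l)) - 1 := by
    exact_mod_cast hlt
  have hlt' : (1 + t) ^ (1 - 2 * l) < (1 - 2 * l) * k ^ 2 / (3 * N) / ε + 1 := by
    rw [one_div] at hlt
    exact (Real.lt_rpow_inv_iff_of_pos (by linarith) (by positivity) hr).1 (by linarith)
  have hI := invSqIntegral_le_integral_rpow h.scale hk hka ht
  rw [integral_one_add_rpow (by linarith) ht, show -(2 * l) + 1 = 1 - 2 * l by ring] at hI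
  calc 3 * ε * N * invSqIntegral a t
      ≤ 3 * ε * N * ((k ^ 2)⁻¹ * (((1 + t) ^ (1 - 2 * l) - 1) / (1 - 2 * l))) := by gcongr
    _ < 3 * ε * N * ((k ^ 2)⁻¹ * (((1 - 2 * l) * k ^ 2 / (3 * N) / ε) / (1 - 2 * l))) := by
        gcongr; linarith
    _ = 1 := by field_simp

theorem exists_lifespan_le_rpow (hl : l < 1 / 2) (hK : 0 < K)
    (hKa : ∀ s, 0 ≤ s → a s ≤ K * (1 + s) ^ l)
    {α : EuclideanSpace ℝ (Fin n)} (hJ : (jac v₀ α).det < 0) :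
    ∃ Q > 0, ∀ ε ∈ Ioc 0 ε₀, lifespan a c (fun x => ε • v₀ x) ≤
      (((Q / ε + 1) ^ (1 / (1 - 2 * l)) - 1 : ℝ) : EReal) := by
  have hr : 0 < 1 - 2 * l := by linarith
  obtain ⟨C, hC, hneg⟩ := exists_det_V_neg h.scale h1 h.speed_pos (h.mul_norm_le α) hJ
  -- Chosen so that the lower bound for εI(t) equals C exactly at the claimed time.
  refine ⟨C * K ^ 2 * (1 - 2 * l), by positivity, fun ε hε => ?_⟩
  have hε0 := hε.1
  set t := (C * K ^ 2 * (1 - 2 * l) / ε + 1) ^ (1 / (1 - 2 * l)) - 1 with ht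
  have ht0 : 0 ≤ t := by
    have : 1 ≤ C * K ^ 2 * (1 - 2 * l) / ε + 1 := by
      have : 0 < C * K ^ 2 * (1 - 2 * l) / ε := by positivity
      linarith
    exact sub_nonneg.2 (Real.one_le_rpow this (by positivity))
  refine lifespan_le h.speed_pos h.scale h.smooth (h.norm_smul_lt (Ioc_subset_Icc_self hε)) ht0
    (hneg ε hε t ht0 ?_).le
  have hI := integral_rpow_le_invSqIntegral h.scale hKa ht0
  rw [integral_one_add_rpow (by linarith) ht0, show -(2 * l) + 1 = 1 - 2 * l by ring] at hI
  have h2 : (1 + t) ^ (1 - 2 * l) = C * K ^ 2 * (1 - 2 * l) / ε + 1 := by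
    rw [ht, add_sub_cancel, ← Real.rpow_mul (by positivity), one_div, inv_mul_cancel₀ hr.ne',
      Real.rpow_one]
  rw [h2, add_sub_cancel_right] at hI
  calc C = ε * ((K ^ 2)⁻¹ * (C * K ^ 2 * (1 - 2 * l) / ε / (1 - 2 * l))) := by field_simp
    _ ≤ _ := by gcongr

theorem exists_exp_le_lifespan (hk : 0 < k)
    (hka : ∀ s, 0 ≤ s → k * (1 + s) ^ (1 / 2 : ℝ) ≤ a s) :
    ∃ P > 0, ∀ ε ∈ Ioc 0 ε₀, ((Real.exp (P / ε) - 1 : ℝ) : EReal)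
      ≤ lifespan a c (fun x => ε • v₀ x) := by
  have hN := h.bound_pos
  refine ⟨k ^ 2 / (3 * N), by positivity, fun ε hε =>
    h.le_lifespan_of_small h1 (Ioc_subset_Icc_self hε) fun t ht hlt => ?_⟩
  have hε0 := hε.1
  have hlt : t < Real.exp (k ^ 2 / (3 * N) / ε) - 1 := by exact_mod_cast hlt
  have hlt' : Real.log (1 + t) < k ^ 2 / (3 * N) / ε :=
    (Real.log_lt_iff_lt_exp (by linarith)).2 (by linarith)
  have hI := invSqIntegral_le_integral_rpow h.scale hk hka ht
  rw [show -(2 * (1 / 2 : ℝ)) = -1 by norm_num, integral_one_add_rpow_neg_one ht] at hI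
  calc 3 * ε * N * invSqIntegral a t
      ≤ 3 * ε * N * ((k ^ 2)⁻¹ * Real.log (1 + t)) := by gcongr
    _ < 3 * ε * N * ((k ^ 2)⁻¹ * (k ^ 2 / (3 * N) / ε)) := by gcongr
    _ = 1 := by field_simp

theorem exists_lifespan_le_exp (hK : 0 < K)
    (hKa : ∀ s, 0 ≤ s → a s ≤ K * (1 + s) ^ (1 / 2 : ℝ))
    {α : EuclideanSpace ℝ (Fin n)} (hJ : (jac v₀ α).det < 0) :
    ∃ P > 0, ∀ ε ∈ Ioc 0 ε₀, lifespan a c (fun x => ε • v₀ x) ≤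
      ((Real.exp (P / ε) - 1 : ℝ) : EReal) := by
  obtain ⟨C, hC, hneg⟩ := exists_det_V_neg h.scale h1 h.speed_pos (h.mul_norm_le α) hJ
  refine ⟨C * K ^ 2, by positivity, fun ε hε => ?_⟩
  have hε0 := hε.1
  set t := Real.exp (C * K ^ 2 / ε) - 1 with ht
  have ht0 : 0 ≤ t := sub_nonneg.2 (Real.one_le_exp (by positivity))
  refine lifespan_le h.speed_pos h.scale h.smooth (h.norm_smul_lt (Ioc_subset_Icc_self hε)) ht0
    (hneg ε hε t ht0 ?_).le
  have hI := integral_rpow_le_invSqIntegral h.scale hKa ht0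
  rw [show -(2 * (1 / 2 : ℝ)) = -1 by norm_num, integral_one_add_rpow_neg_one ht0, ht,
    add_sub_cancel, Real.log_exp] at hI
  calc C = ε * ((K ^ 2)⁻¹ * (C * K ^ 2 / ε)) := by field_simp
    _ ≤ _ := by gcongr

omit h1 in
theorem V_of_H4 (h4 : H4 a) (hε : ε ∈ Icc 0 ε₀) {t : ℝ} (ht : 0 ≤ t)
    (α : EuclideanSpace ℝ (Fin n)) : V a c ε v₀ t α = 1 + (ε * t) • jac v₀ α := by
  have hc := h.speed_pos
  have hs : ∀ s ∈ uIcc 0 t, a s = 1 := fun s hs => h4 s (by rw [uIcc_of_le ht] at hs; exact hs.1)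
  have hR : radicand 1 c (ε • v₀ α) = c ^ 2 := by simp [radicand]
  have hm : mainCoeff a c (ε • v₀ α) t = t := by
    have : mainCoeff a c (ε • v₀ α) t = ∫ _ in (0 : ℝ)..t, (1 : ℝ) :=
      intervalIntegral.integral_congr fun s h => by
        simp only [hs s h, hR, Real.sqrt_sq hc.le]
        field_simp
    simpa using this
  have hp : perpCoeff a c (ε • v₀ α) t = 0 := by
    have : perpCoeff a c (ε • v₀ α) t = ∫ _ in (0 : ℝ)..t, (0 : ℝ) :=
      intervalIntegral.integral_congr fun s h => by simp [hs s h]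
    simpa using this
  rw [V_eq h.scale.pos ht (h.norm_smul_lt hε α), hm, hp]
  simp

omit h1 in
theorem exists_lifespan_le_of_H4 (h4 : H4 a) : ∃ Q > 0, ∀ ε ∈ Ioc 0 ε₀,
    lifespan a c (fun x => ε • v₀ x) ≠ ⊤ →
      lifespan a c (fun x => ε • v₀ x) ≤ ((Q / ε : ℝ) : EReal) := by
  -- Here V = I + εt Dv₀, so the bad values τ = εt do not depend on ε: either one τ bounds every
  -- life span by τ/ε, or every life span is infinite.
  by_cases hex : ∃ τ : ℝ, ∃ α, 0 ≤ τ ∧ (1 + τ • jac v₀ α).det ≤ 0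
  · obtain ⟨τ, α, hτ, hdet⟩ := hex
    have hτ0 : 0 < τ := hτ.lt_of_ne (by rintro rfl; norm_num at hdet)
    refine ⟨τ, hτ0, fun ε hε _ => ?_⟩
    have hε' := Ioc_subset_Icc_self hε
    have ht : 0 ≤ τ / ε := div_nonneg hτ hε.1.le
    refine lifespan_le h.speed_pos h.scale h.smooth (h.norm_smul_lt hε') ht (α := α) ?_
    rw [h.V_of_H4 h4 hε' ht, mul_div_cancel₀ _ hε.1.ne']
    exact hdet
  · push Not at hex
    refine ⟨1, one_pos, fun ε hε hne => absurd (top_le_iff.1 ?_) hne⟩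
    have hε' := Ioc_subset_Icc_self hε
    refine le_lifespan h.speed_pos h.scale h.smooth (h.norm_smul_lt hε') fun t ht α => ?_
    rw [h.V_of_H4 h4 hε' ht.1]
    exact hex _ _ (mul_nonneg hε.1.le ht.1)

omit h1 in
/-- The life span estimates for `a ∼ (1 + t)^l` with `l < 1 / 2`, including `l = 0`. -/
theorem lifespan_bounds_rpow (hl : (H3 a l ∧ l ≠ 1 / 2) ∨ (H4 a ∧ l = 0)) :
    ∃ P P' Q Q' : ℝ, 0 < P ∧ 0 < P' ∧ 0 < Q ∧ 0 < Q' ∧ ∀ ε ∈ Ioc 0 ε₀,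
      ((ε ^ (P / (2 * l - 1)) - 1 : ℝ) : EReal) ≤ lifespan a c (fun x => ε • v₀ x) ∧
      (((Q / ε + 1) ^ (1 / (1 - 2 * l)) - 1 : ℝ) : EReal) ≤ lifespan a c (fun x => ε • v₀ x) ∧
      ((∃ α, (jac v₀ α).det < 0) ∨ (H4 a ∧ lifespan a c (fun x => ε • v₀ x) ≠ ⊤) →
        lifespan a c (fun x => ε • v₀ x) ≤ ((ε ^ (P' / (2 * l - 1)) - 1 : ℝ) : EReal) ∧
        lifespan a c (fun x => ε • v₀ x) ≤
          (((Q' / ε + 1) ^ (1 / (1 - 2 * l)) - 1 : ℝ) : EReal)) := by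
  obtain ⟨h1, hl2, k, K, hk, hK, hka, hKa⟩ : (∀ s, 0 ≤ s → 1 ≤ a s) ∧ l < 1 / 2 ∧
      ∃ k K : ℝ, 0 < k ∧ 0 < K ∧ (∀ s, 0 ≤ s → k * (1 + s) ^ l ≤ a s) ∧
        ∀ s, 0 ≤ s → a s ≤ K * (1 + s) ^ l := by
    rcases hl with ⟨⟨hd, -, hl, k, K, hk, hK, hb⟩, hne⟩ | ⟨h4, rfl⟩
    · exact ⟨h.scale.one_le fun t ht => (hd t ht).1, lt_of_le_of_ne hl hne, k, K, hk, hK,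
        fun s hs => (hb s hs).1, fun s hs => (hb s hs).2⟩
    · exact ⟨fun s hs => (h4 s hs).ge, by norm_num, 1, 1, one_pos, one_pos,
        fun s hs => by simp [h4 s hs], fun s hs => by simp [h4 s hs]⟩
  have hr : 0 < 1 - 2 * l := by linarith
  obtain ⟨Q, hQ, hlow⟩ := h.exists_rpow_le_lifespan h1 hl2 hk hka
  obtain ⟨P, hP, hPQ⟩ := exists_rpow_le_div_add_one hQ
  obtain ⟨Q', hQ', hup⟩ : ∃ Q' > 0, ∀ ε ∈ Ioc 0 ε₀,
      (∃ α, (jac v₀ α).det < 0) ∨ (H4 a ∧ lifespan a c (fun x => ε • v₀ x) ≠ ⊤) →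
        lifespan a c (fun x => ε • v₀ x) ≤
          (((Q' / ε + 1) ^ (1 / (1 - 2 * l)) - 1 : ℝ) : EReal) := by
    by_cases hJ : ∃ α, (jac v₀ α).det < 0
    · obtain ⟨α, hα⟩ := hJ
      obtain ⟨Q', hQ', hup⟩ := h.exists_lifespan_le_rpow h1 hl2 hK hKa hα
      exact ⟨Q', hQ', fun ε hε _ => hup ε hε⟩
    · rcases hl with ⟨⟨hd, -⟩, -⟩ | ⟨h4, rfl⟩
      · refine ⟨1, one_pos, fun ε hε hor => ?_⟩
        rcases hor with hJ' | ⟨h4, -⟩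
        · exact absurd hJ' hJ
        -- H₃ and H₄ exclude each other: a constant has zero derivative.
        · refine absurd (hd 0 le_rfl).1 (not_lt.2 (le_of_eq ?_))
          have : dot a 0 = derivWithin (fun _ : ℝ => (1 : ℝ)) (Ici 0) 0 :=
            derivWithin_congr (fun s hs => h4 s hs) (h4 0 le_rfl)
          simp [this]
      · obtain ⟨Q', hQ', hup⟩ := h.exists_lifespan_le_of_H4 h4
        refine ⟨Q', hQ', fun ε hε hor => ?_⟩
        rcases hor with hJ' | ⟨-, hne⟩
        · exact absurd hJ' hJ
        · simpa using hup ε hε hne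
  obtain ⟨P', hP', hPQ'⟩ := exists_div_add_one_le_rpow Q'
  refine ⟨P, P', Q, Q', hP, hP', hQ, hQ', fun ε hε => ?_⟩
  have hε' : ε ∈ Ioc (0 : ℝ) (1 / 2) := ⟨hε.1, hε.2.trans h.le_half⟩
  have hε0 := hε.1
  refine ⟨le_trans ?_ (hlow ε hε), hlow ε hε, fun hor => ⟨(hup ε hε hor).trans ?_, hup ε hε hor⟩⟩
  · rw [rpow_div_sub_one hε0]
    have := Real.rpow_le_rpow (by positivity) (hPQ ε hε') (by positivity : 0 ≤ 1 / (1 - 2 * l))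
    exact_mod_cast sub_le_sub_right this 1
  · rw [rpow_div_sub_one hε0]
    have := Real.rpow_le_rpow (by positivity) (hPQ' ε hε') (by positivity : 0 ≤ 1 / (1 - 2 * l))
    exact_mod_cast sub_le_sub_right this 1

omit h1 in
/-- The life span estimates for `a ∼ (1 + t)^(1/2)`. -/
theorem lifespan_bounds_exp (hl : H3 a (1 / 2)) :
    ∃ P P' : ℝ, 0 < P ∧ 0 < P' ∧ ∀ ε ∈ Ioc 0 ε₀,
      ((Real.exp (P / ε) - 1 : ℝ) : EReal) ≤ lifespan a c (fun x => ε • v₀ x) ∧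
      ((∃ α, (jac v₀ α).det < 0) →
        lifespan a c (fun x => ε • v₀ x) ≤ ((Real.exp (P' / ε) - 1 : ℝ) : EReal)) := by
  obtain ⟨hd, -, -, k, K, hk, hK, hb⟩ := hl
  have h1 := h.scale.one_le fun t ht => (hd t ht).1
  obtain ⟨P, hP, hlow⟩ := h.exists_exp_le_lifespan h1 hk fun s hs => (hb s hs).1
  by_cases hJ : ∃ α, (jac v₀ α).det < 0
  · obtain ⟨α, hα⟩ := hJ
    obtain ⟨P', hP', hup⟩ := h.exists_lifespan_le_exp h1 hK (fun s hs => (hb s hs).2) hα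
    exact ⟨P, P', hP, hP', fun ε hε => ⟨hlow ε hε, fun _ => hup ε hε⟩⟩
  · exact ⟨P, 1, hP, one_pos, fun ε hε => ⟨hlow ε hε, fun hJ' => absurd hJ' hJ⟩⟩

omit h1 in
theorem lifespan_lt_top (hl : H3 a l) (hJ : ∃ α, (jac v₀ α).det < 0) (hε : ε ∈ Ioc 0 ε₀) :
    lifespan a c (fun x => ε • v₀ x) < ⊤ := by
  by_cases h2 : l = 1 / 2
  · subst h2
    obtain ⟨P, P', -, -, hb⟩ := h.lifespan_bounds_exp hl
    exact lt_of_le_of_lt ((hb ε hε).2 hJ) (EReal.coe_lt_top _)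
  · obtain ⟨P, P', Q, Q', -, -, -, -, hb⟩ := h.lifespan_bounds_rpow (Or.inl ⟨hl, h2⟩)
    exact lt_of_le_of_lt ((hb ε hε).2.2 (Or.inl hJ)).1 (EReal.coe_lt_top _)

end SmallData

end LifespanBounds

/-! ### Dimension one: the sign of v₀' and gradient blow-up. -/

section OneDimension

variable {a : ℝ → ℝ} {c ε ε₀ N : ℝ} {v₀ : EuclideanSpace ℝ (Fin 1) → EuclideanSpace ℝ (Fin 1)}

theorem perp_fin_one (u η : EuclideanSpace ℝ (Fin 1)) : perp u η = 0 := by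
  ext j
  rw [perp_apply, Subsingleton.elim j 0]
  simp [EuclideanSpace.real_norm_sq_eq, PiLp.inner_apply]
  ring

theorem det_V_fin_one (ha : ∀ s, 0 ≤ s → 0 < a s) {t : ℝ} (ht : 0 ≤ t)
    {α : EuclideanSpace ℝ (Fin 1)} (hu : ‖ε • v₀ α‖ < c) (i : Fin 1) :
    (V a c ε v₀ t α).det = 1 + ε * mainCoeff a c (ε • v₀ α) t * jac v₀ α i i := by
  have hP : ‖v₀ α‖ ^ 2 • (1 : Matrix (Fin 1) (Fin 1) ℝ)
      - (Matrix.of fun i j => v₀ α i * v₀ α j) = 0 := by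
    ext j k
    rw [Subsingleton.elim j 0, Subsingleton.elim k 0]
    simp [EuclideanSpace.real_norm_sq_eq]
    ring
  rw [V_eq ha ht hu, hP, Subsingleton.elim i 0]
  simp

/-- The differentiated transport identity becomes scalar in dimension one; the witness is the point
reached at time t by the characteristic from α. -/
theorem IsClassicalSolution.jac_mul_det_V {T : EReal}
    {v : ℝ → EuclideanSpace ℝ (Fin 1) → EuclideanSpace ℝ (Fin 1)}
    (hv : IsClassicalSolution a c (fun x => ε • v₀ x) T v) (hc : 0 < c) (ha : IsScaleFactor a)
    (hv₀ : ContDiff ℝ 1 v₀) (hu : ∀ α, ‖ε • v₀ α‖ < c) {t : ℝ} (ht : t ∈ slab T)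
    (α : EuclideanSpace ℝ (Fin 1)) (i : Fin 1) :
    ∃ x, jac (v t) x i i * (V a c ε v₀ t α).det =
      c ^ 3 * a t ^ 2 / √(radicand (a t) c (ε • v₀ α)) ^ 3 * (ε * jac v₀ α i i) := by
  rw [← isClassicalSolution_extendLeft_iff] at hv
  have h1 := DFunLike.congr_fun (hv.fderiv_comp_flowDeriv hc ha.extend ha.continuous_extendLeft
    ha.extendLeft_pos hu (hv₀.const_smul ε) ht α) (EuclideanSpace.single i 1)
  have hfd : fderiv ℝ (fun x => ε • v₀ x) α = ε • fderiv ℝ v₀ α :=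
    fderiv_fun_const_smul (hv₀.differentiable one_ne_zero α) ε
  have hF : flowDeriv (extendLeft a) c (fun x => ε • v₀ x) t α (EuclideanSpace.single i 1) =
      (V a c ε v₀ t α).det • EuclideanSpace.single i (1 : ℝ) := by
    ext j
    rw [det_V_fin_one ha.pos ht.1 (hu α) i, Subsingleton.elim j i]
    simp [flowDeriv, perp_fin_one, hfd, mainCoeff_extendLeft ht.1, jac]
    ring
  refine ⟨flow (extendLeft a) c (fun x => ε • v₀ x) (t, α), ?_⟩
  generalize (V a c ε v₀ t α).det = d at hF ⊢
  have h2 := congrArg (fun z : EuclideanSpace ℝ (Fin 1) => z i) h1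
  simp only [ContinuousLinearMap.comp_apply, hF, hfd, map_smul] at h2
  simp [velocityDeriv, perp_fin_one, extendLeft_of_nonneg ht.1] at h2
  simp only [jac, Matrix.of_apply]
  linarith

namespace SmallData

variable (h : SmallData a c ε₀ N v₀)
include h

theorem abs_jac_le (α : EuclideanSpace ℝ (Fin 1)) (i : Fin 1) : |jac v₀ α i i| ≤ N := by
  have h1 := PiLp.norm_apply_le (fderiv ℝ v₀ α (EuclideanSpace.single i 1)) i
  have h2 := (fderiv ℝ v₀ α).le_opNorm (EuclideanSpace.single i (1 : ℝ))
  have h3 := h.fderiv_le α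
  simp at h2
  exact h1.trans (h2.trans h3)

variable (h1 : ∀ s, 0 ≤ s → 1 ≤ a s)
include h1

/-- On a characteristic whose determinant vanishes or is negative soon after t, the determinant at t
is at most 4εN(T - t). When this is at most 1/2, ε|v₀'| is at least 1/(4T), so v_x is at least of
order 1/(T - t). -/
theorem exists_large_jac (hmono : MonotoneOn a (Ici 0)) (hε : ε ∈ Ioc 0 ε₀) {T : ℝ}
    (hT : lifespan a c (fun x => ε • v₀ x) = (T : EReal))
    {v : ℝ → EuclideanSpace ℝ (Fin 1) → EuclideanSpace ℝ (Fin 1)}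
    (hv : IsClassicalSolution a c (fun x => ε • v₀ x) T v) {t : ℝ} (ht0 : 0 ≤ t) (htT : t < T)
    (hnear : 4 * ε * N * (T - t) ≤ 1 / 2) (i : Fin 1) :
    ∃ x, 1 ≤ |jac (v t) x i i| * (4 * ε * N * (T - t)) * (4 * T * a T) := by
  have hN := h.bound_pos
  have hε0 := hε.1
  have hε' := Ioc_subset_Icc_self hε
  have hu := h.norm_smul_lt hε'
  -- At time T itself the determinant may be positive for every α, since the infimum over α need not
  -- be attained. It must fail before 2T - t, a time beyond T, and t' - t is still at most 2(T - t).
  obtain ⟨t', ht', htt', α, hα⟩ : ∃ t', T ≤ t' ∧ t' < 2 * T - t ∧ ∃ α,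
      (V a c ε v₀ t' α).det ≤ 0 := by
    by_contra hno
    push Not at hno
    have hle := le_lifespan h.speed_pos h.scale h.smooth hu (T := ((2 * T - t : ℝ) : EReal))
      fun s hs α => by
        rcases lt_or_ge s T with hsT | hsT
        · exact det_V_pos_of_lt_lifespan h.speed_pos h.scale h.smooth hu hs.1
            (by rw [hT]; exact_mod_cast hsT) α
        · exact hno s hsT (by exact_mod_cast hs.2) α
    rw [hT, EReal.coe_le_coe_iff] at hle
    linarith
  have htslab : t ∈ slab (T : EReal) := ⟨ht0, by exact_mod_cast htT⟩
  obtain ⟨x, hx⟩ := hv.jac_mul_det_V h.speed_pos h.scale h.smooth hu htslab α i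
  refine ⟨x, ?_⟩
  have hVpos := det_V_pos_of_lt_lifespan h.speed_pos h.scale h.smooth hu ht0
    (by rw [hT]; exact_mod_cast htT) α
  obtain ⟨d1, d2⟩ := mainCoeff_sub_le h.scale h1 h.speed_pos (h.norm_smul_le hε' α) ht0
    (htT.le.trans ht')
  obtain ⟨m1, m2⟩ := mainCoeff_bounds h.scale h1 h.speed_pos (h.norm_smul_le hε' α) ht0
  have hI := invSqIntegral_le h.scale h1 ht0
  have hI0 := invSqIntegral_nonneg h.scale ht0
  have hJN := h.abs_jac_le α i
  rw [det_V_fin_one h.scale.pos (ht0.trans (htT.le.trans ht')) (hu α) i] at hα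
  have hD := (mainCoeff_integrand_bounds (h1 t ht0) h.speed_pos (h.norm_smul_le hε' α)).1
  have hVeq := det_V_fin_one h.scale.pos ht0 (hu α) i
  set m := mainCoeff a c (ε • v₀ α) t
  set m' := mainCoeff a c (ε • v₀ α) t'
  set J := jac v₀ α i i
  set W := (V a c ε v₀ t α).det
  set R := √(radicand (a t) c (ε • v₀ α)) ^ 3
  have hat := h.scale.pos t ht0
  have hD' : 1 ≤ c ^ 3 * a t ^ 2 / R * a T := by
    have e : c ^ 3 * a t ^ 2 / R = c ^ 3 * a t / R * a t := by ring
    have haT : a t ≤ a T := hmono ht0 (ht0.trans htT.le) htT.le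
    have h5 := mul_le_mul_of_nonneg_right hD (mul_nonneg hat.le hat.le)
    have h6 : (a t ^ 2)⁻¹ * (a t * a t) = 1 := by field_simp
    have h7 : 0 ≤ c ^ 3 * a t ^ 2 / R := by
      have := h.speed_pos
      positivity
    calc (1 : ℝ) ≤ c ^ 3 * a t ^ 2 / R * a t := by rw [e]; linarith
      _ ≤ _ := by gcongr
  have hWle : W ≤ 4 * ε * N * (T - t) := by
    have e : W = (1 + ε * m' * J) - ε * (m' - m) * J := by rw [hVeq]; ring
    have htt : 0 ≤ t' - t := by linarith
    have h8 : -(ε * (m' - m) * J) ≤ ε * (2 * (t' - t)) * N := by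
      calc -(ε * (m' - m) * J) ≤ |ε * (m' - m) * J| := neg_le_abs _
        _ = ε * (m' - m) * |J| := by rw [abs_mul, abs_of_nonneg (by positivity)]
        _ ≤ _ := by gcongr
    have h9 : ε * (2 * (t' - t)) * N ≤ ε * (2 * (2 * (T - t))) * N := by
      gcongr
      linarith
    linarith
  have hJ : 1 ≤ 4 * T * (ε * |J|) := by
    have h10 : 1 / 2 ≤ ε * m * |J| := by
      calc 1 / 2 ≤ -(ε * m * J) := by linarith
        _ ≤ |ε * m * J| := neg_le_abs _
        _ = ε * m * |J| := by rw [abs_mul, abs_of_nonneg (mul_nonneg hε0.le (hI0.trans m1))]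
    have h11 : ε * m * |J| ≤ ε * (2 * T) * |J| := by
      gcongr
      linarith
    linarith
  have habs : |jac (v t) x i i| * W = c ^ 3 * a t ^ 2 / R * (ε * |J|) := by
    have hR : 0 ≤ c ^ 3 * a t ^ 2 / R := by
      have := h.speed_pos
      positivity
    have := congrArg abs hx
    rwa [abs_mul, abs_of_pos hVpos, abs_mul, abs_mul, abs_of_pos hε0, abs_of_nonneg hR] at this
  have hT0 : 0 < T := ht0.trans_lt htT
  have haT := h.scale.pos T hT0.le
  calc (1 : ℝ) ≤ (c ^ 3 * a t ^ 2 / R * a T) * (4 * T * (ε * |J|)) := one_le_mul_of_one_le_of_one_le hD' hJ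
    _ = |jac (v t) x i i| * W * (4 * T * a T) := by rw [habs]; ring
    _ ≤ _ := by gcongr

/-- In one space dimension the gradient blows up at the end of the life span. -/
theorem tendsto_iSup_jac (hmono : MonotoneOn a (Ici 0)) (hε : ε ∈ Ioc 0 ε₀) {T : ℝ}
    (hT0 : 0 < T) (hT : lifespan a c (fun x => ε • v₀ x) = (T : EReal))
    {v : ℝ → EuclideanSpace ℝ (Fin 1) → EuclideanSpace ℝ (Fin 1)}
    (hv : IsClassicalSolution a c (fun x => ε • v₀ x) T v) (i : Fin 1) :
    Tendsto (fun t => ⨆ x, ‖jac (v t) x i i‖ₑ) (𝓝[<] T) (𝓝 ⊤) := by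
  rw [ENNReal.tendsto_nhds_top_iff_nnreal]
  intro M
  have hN := h.bound_pos
  have hε0 := hε.1
  have hlim : Tendsto (fun t => 4 * ε * N * (T - t)) (𝓝[<] T) (𝓝 0) := by
    have : Continuous fun t => 4 * ε * N * (T - t) := by fun_prop
    simpa using (this.tendsto T).mono_left nhdsWithin_le_nhds
  have hlim' : Tendsto (fun t => M * (4 * ε * N * (T - t)) * (4 * T * a T)) (𝓝[<] T) (𝓝 0) := by
    simpa using (hlim.const_mul (M : ℝ)).mul_const (4 * T * a T)
  filter_upwards [self_mem_nhdsWithin, mem_nhdsWithin_of_mem_nhds (lt_mem_nhds hT0),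
    hlim.eventually (ge_mem_nhds (by norm_num : (0 : ℝ) < 1 / 2)),
    hlim'.eventually (gt_mem_nhds one_pos)] with t htT ht0 hn hsmall
  obtain ⟨x, hx⟩ := h.exists_large_jac h1 hmono hε hT hv ht0.le htT hn i
  refine lt_of_lt_of_le ?_ (le_iSup _ x)
  have hpos : 0 ≤ (4 * ε * N * (T - t)) * (4 * T * a T) := by
    have := h.scale.pos T hT0.le
    have : 0 ≤ T - t := sub_nonneg.2 (le_of_lt htT)
    positivity
  have hlt : (M : ℝ) < |jac (v t) x i i| := by
    by_contra hge
    have := mul_le_mul_of_nonneg_right (not_lt.1 hge) hpos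
    linarith
  rw [enorm_eq_nnnorm, ENNReal.coe_lt_coe, ← NNReal.coe_lt_coe, coe_nnnorm]
  exact hlt

omit h1 in
theorem det_V_pos_of_iInf_nonneg (h1 : ∀ s, 0 ≤ s → 1 ≤ a s) (hε : ε ∈ Icc 0 ε₀) (i : Fin 1)
    (hinf : 0 ≤ ⨅ α, jac v₀ α i i) {t : ℝ} (ht : 0 ≤ t) (α : EuclideanSpace ℝ (Fin 1)) :
    0 < (V a c ε v₀ t α).det := by
  -- An infimum over a family unbounded below would be 0 by default, so the bound on Dv₀ is needed
  -- to read off v₀' ≥ 0.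
  have hbdd : BddBelow (range fun α => jac v₀ α i i) :=
    ⟨-N, by rintro _ ⟨β, rfl⟩; exact (abs_le.1 (h.abs_jac_le β i)).1⟩
  have hJ : 0 ≤ jac v₀ α i i := hinf.trans (ciInf_le hbdd α)
  rw [det_V_fin_one h.scale.pos ht (h.norm_smul_lt hε α) i]
  have := (invSqIntegral_nonneg h.scale ht).trans
    (mainCoeff_bounds h.scale h1 h.speed_pos (h.norm_smul_le hε α) ht).1
  have hε0 := hε.1
  positivity

end SmallData

end OneDimension

/-! ### Choice of ε₀ and assembly of the theorem. -/

theorem exists_smallData {n : ℕ} {c : ℝ} (hc : 0 < c) {a : ℝ → ℝ} (ha : IsScaleFactor a)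
    {v₀ : EuclideanSpace ℝ (Fin n) → EuclideanSpace ℝ (Fin n)} (hv₀ : BoundedC2 v₀) :
    ∃ ε₀ N : ℝ, 0 < ε₀ ∧ SmallData a c ε₀ N v₀ ∧
      (H1 a ∨ H2 a → ∀ ε ∈ Icc 0 ε₀, ∀ t, 0 ≤ t → 3 * ε * N * invSqIntegral a t < 1) := by
  obtain ⟨hC2, N₀, hN₀⟩ := hv₀
  obtain ⟨B, hB0, hB⟩ : ∃ B : ℝ, 0 ≤ B ∧ (H1 a ∨ H2 a → ∀ t, 0 ≤ t → invSqIntegral a t ≤ B) := by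
    by_cases h : H1 a ∨ H2 a
    · obtain ⟨B, hB⟩ := exists_invSqIntegral_le ha h
      exact ⟨B, (invSqIntegral_nonneg ha le_rfl).trans (hB 0 le_rfl), fun _ => hB⟩
    · exact ⟨0, le_rfl, fun h' => absurd h' h⟩
  set N := max N₀ 1
  have hN : 0 < N := lt_of_lt_of_le one_pos (le_max_right _ _)
  refine ⟨min (1 / 2) (min (c / (2 * N)) (1 / (6 * N * (B + 1)))), N, by positivity,
    ⟨hc, ha, hC2.of_le (by norm_num), hN, fun α => (hN₀ α).2.1.trans (le_max_left _ _),
      min_le_left _ _, fun α => ?_⟩, fun h ε hε t ht => ?_⟩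
  · calc _ ≤ c / (2 * N) * N := by
          gcongr
          · exact (min_le_right _ _).trans (min_le_left _ _)
          · exact (hN₀ α).1.trans (le_max_left _ _)
      _ = c / 2 := by field_simp
  · have hε1 : ε ≤ 1 / (6 * N * (B + 1)) :=
      hε.2.trans ((min_le_right _ _).trans (min_le_right _ _))
    have hε0 := hε.1
    have hI0 := invSqIntegral_nonneg ha ht
    calc 3 * ε * N * invSqIntegral a t ≤ 3 * (1 / (6 * N * (B + 1))) * N * B := by
          gcongr
          exact hB h t ht
      _ = B / (2 * (B + 1)) := by field_simp; ring
      _ < 1 := by rw [div_lt_one (by positivity)]; linarith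

theorem V_zero_data {n : ℕ} {a : ℝ → ℝ} {c : ℝ}
    {v₀ : EuclideanSpace ℝ (Fin n) → EuclideanSpace ℝ (Fin n)} (t : ℝ)
    (α : EuclideanSpace ℝ (Fin n)) : V a c 0 v₀ t α = 1 := by
  simp [V]

end RelBurgers

theorem theorem1 (n : ℕ) (hn : 1 ≤ n) (c : ℝ) (hc : 0 < c)
    (a : ℝ → ℝ) (ha : RelBurgers.IsScaleFactor a)
    (v₀ : EuclideanSpace ℝ (Fin n) → EuclideanSpace ℝ (Fin n)) (hv₀ : RelBurgers.BoundedC2 v₀) :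
    ∃ ε₀ : ℝ, 0 < ε₀ ∧
      -- the data are subluminal, so that `f₀` and `V` make sense
      (∀ α, ε₀ * ‖v₀ α‖ < c) ∧
      -- a classical solution lives on the whole of `[0, T(ε))`
      (∀ ε ∈ Icc 0 ε₀, ∃ v, RelBurgers.IsClassicalSolution a c (fun x => ε • v₀ x)
        (RelBurgers.lifespan a c (fun x => ε • v₀ x)) v) ∧
      -- vanishing data
      RelBurgers.lifespan a c (fun x => (0 : ℝ) • v₀ x) = ⊤ ∧
      -- life span under `H₁` or `H₂`
      (RelBurgers.H1 a ∨ RelBurgers.H2 a →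
        ∀ ε ∈ Icc 0 ε₀, RelBurgers.lifespan a c (fun x => ε • v₀ x) = ⊤) ∧
      -- life span under `H₃` with `l < 1/2`, or under `H₄` (with `l = 0`)
      (∀ l : ℝ, (RelBurgers.H3 a l ∧ l ≠ 1 / 2) ∨ (RelBurgers.H4 a ∧ l = 0) →
        ∃ P P' Q Q' : ℝ, 0 < P ∧ 0 < P' ∧ 0 < Q ∧ 0 < Q' ∧ ∀ ε ∈ Ioc 0 ε₀,
          ((ε ^ (P / (2 * l - 1)) - 1 : ℝ) : EReal)
              ≤ RelBurgers.lifespan a c (fun x => ε • v₀ x) ∧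
          (((Q / ε + 1) ^ (1 / (1 - 2 * l)) - 1 : ℝ) : EReal)
              ≤ RelBurgers.lifespan a c (fun x => ε • v₀ x) ∧
          ((∃ α, (RelBurgers.jac v₀ α).det < 0) ∨
              (RelBurgers.H4 a ∧ RelBurgers.lifespan a c (fun x => ε • v₀ x) ≠ ⊤) →
            RelBurgers.lifespan a c (fun x => ε • v₀ x)
                ≤ ((ε ^ (P' / (2 * l - 1)) - 1 : ℝ) : EReal) ∧
            RelBurgers.lifespan a c (fun x => ε • v₀ x)
                ≤ (((Q' / ε + 1) ^ (1 / (1 - 2 * l)) - 1 : ℝ) : EReal))) ∧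
      -- life span under `H₃` with `l = 1/2`, in particular for `a(t) = (1 + t)^(1/2)`
      (RelBurgers.H3 a (1 / 2) →
        ∃ P P' : ℝ, 0 < P ∧ 0 < P' ∧ ∀ ε ∈ Ioc 0 ε₀,
          ((Real.exp (P / ε) - 1 : ℝ) : EReal)
              ≤ RelBurgers.lifespan a c (fun x => ε • v₀ x) ∧
          ((∃ α, (RelBurgers.jac v₀ α).det < 0) →
            RelBurgers.lifespan a c (fun x => ε • v₀ x)
                ≤ ((Real.exp (P' / ε) - 1 : ℝ) : EReal))) ∧
      -- `n = 1` under `H₃`; the only entry of the Jacobian matrix of `v₀` is `v₀'`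
      (∀ l : ℝ, RelBurgers.H3 a l → ∀ i : Fin n, n = 1 →
        (0 ≤ (⨅ α, RelBurgers.jac v₀ α i i) → ∀ ε ∈ Icc 0 ε₀,
          ∃ v, RelBurgers.IsClassicalSolution a c (fun x => ε • v₀ x) ⊤ v) ∧
        ((⨅ α, RelBurgers.jac v₀ α i i) < 0 → ∀ ε ∈ Ioc 0 ε₀,
          ∃ T : ℝ, 0 < T ∧ RelBurgers.lifespan a c (fun x => ε • v₀ x) = (T : EReal) ∧
            ∀ v, RelBurgers.IsClassicalSolution a c (fun x => ε • v₀ x) (T : EReal) v →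
              Tendsto (fun t => ⨆ x, ‖RelBurgers.jac (v t) x i i‖ₑ) (𝓝[<] T) (𝓝 ⊤))) ∧
      -- `n > 1` under `H₃`
      (∀ l : ℝ, RelBurgers.H3 a l → 1 < n → ∀ ε ∈ Icc 0 ε₀,
        ((∃ v, RelBurgers.IsClassicalSolution a c (fun x => ε • v₀ x) ⊤ v) ↔
          ∀ t : ℝ, 0 < t → ∀ α, 0 < (RelBurgers.V a c ε v₀ t α).det)) := by
  obtain ⟨ε₀, N, hε₀, h, hglob⟩ := RelBurgers.exists_smallData hc ha hv₀
  have h0mem : (0 : ℝ) ∈ Icc 0 ε₀ := ⟨le_rfl, hε₀.le⟩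
  refine ⟨ε₀, hε₀, fun α => (h.mul_norm_le α).trans_lt (half_lt_self hc), fun ε hε =>
    RelBurgers.exists_solution_lifespan hc ha h.smooth (h.norm_smul_lt hε), ?_, fun hH ε hε => ?_,
    fun l hl => h.lifespan_bounds_rpow hl, h.lifespan_bounds_exp, ?_, ?_⟩
  · refine top_le_iff.1 (RelBurgers.le_lifespan hc ha h.smooth (h.norm_smul_lt h0mem)
      fun t _ α => ?_)
    rw [RelBurgers.V_zero_data, Matrix.det_one]
    exact one_pos
  · have hd : ∀ t, 0 ≤ t → 0 < RelBurgers.dot a t := fun t ht => by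
      rcases hH with hH | hH
      · exact (hH t ht).1
      · exact (hH.1 t ht).1
    exact top_le_iff.1 (h.le_lifespan_of_small (ha.one_le hd) hε
      fun t ht _ => hglob hH ε hε t ht)
  · rintro l hl i rfl
    have hd : ∀ t, 0 ≤ t → 0 < RelBurgers.dot a t := fun t ht => (hl.1 t ht).1
    have h1 := ha.one_le hd
    refine ⟨fun hinf ε hε => ?_, fun hinf ε hε => ?_⟩
    · rw [RelBurgers.exists_solution_iff hc ha h.smooth (h.norm_smul_lt hε)]
      exact fun t ht α => h.det_V_pos_of_iInf_nonneg h1 hε i hinf ht.1 α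
    · obtain ⟨α, hα⟩ := exists_lt_of_ciInf_lt hinf
      have htop := h.lifespan_lt_top hl ⟨α, by
        rwa [Matrix.det_fin_one, Subsingleton.elim 0 i]⟩ hε
      have hpos := h.lifespan_pos h1 hε
      obtain ⟨T, hT⟩ : ∃ T : ℝ, RelBurgers.lifespan a c (fun x => ε • v₀ x) = (T : EReal) :=
        ⟨_, (EReal.coe_toReal htop.ne (bot_lt_iff_ne_bot.1 (bot_le.trans_lt hpos))).symm⟩
      have hT0 : 0 < T := by rw [hT] at hpos; exact_mod_cast hpos
      exact ⟨T, hT0, hT, fun v hv =>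
        h.tendsto_iSup_jac h1 (ha.monotoneOn hd) hε hT0 hT hv i⟩
  · intro l _ _ ε hε
    rw [RelBurgers.exists_solution_iff hc ha h.smooth (h.norm_smul_lt hε)]
    refine ⟨fun H t ht α => H t ⟨ht.le, EReal.coe_lt_top t⟩ α, fun H t ht α => ?_⟩
    -- The criterion assumes positivity only for t > 0; at t = 0 the matrix is I.
    rcases ht.1.eq_or_lt with h0 | h0
    · rw [← h0, RelBurgers.V_zero, Matrix.det_one]
      exact one_pos
    · exact H t h0 α
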